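/- **Setting.** Fix integers $N,d,T\ge 1$ (clients, dimension, horizon), $0\le T_0\le T$, reals $\sigma,\gamma,\lambda_c>0$, $\delta\in(0,1)$, and unknown parameters $\theta_1^*,\dots,\theta_N^*\in\mathbb R^d$. The clients are partitioned into $M$ non-empty clusters $\mathcal C=\{C_1,\dots,C_M\}$ such that $\|\theta_i^*-\theta_j^*\|\le \frac1{N\sqrt T}$ for $i,j$ in the same cluster, and $\|\theta_i^*-\theta_j^*\|\ge\gamma$ for $i,j$ in different clusters. *Pure exploration.* In each round $t=1,\dots,T_0$ every client $i$ receives a set of $K$ arms drawn i.i.d. from a distribution on the unit ball of $\mathbb R^d$ (which may depend on $t$ and $i$) whose second moment matrix $\mathbb E[xx^\top]$ has smallest eigenvalue at least $\lambda_c$; it plays an arm $x_{t,i}$ chosen uniformly at random from this set, independently of the arms, and observes $y_{t,i}=\langle\theta_i^*,x_{t,i}\rangle+\eta_{t,i}$. For each client, arm sets and choices are independent across rounds. The noise variables $\eta_{t,i}\sim\mathcal N(0,\sigma^2)$ are independent across $t$ and $i$ and independent of all arm sets and choices. Let $\mathbf X_i\in\mathbb R^{T_0\times d}$ and $\mathbf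 y_i\in\mathbb R^{T_0}$ be the matrix of played arms and the vector of rewards of client $i$. *Homogeneity test.* For data $(\mathbf X,\mathbf y)$ put $\vartheta=(\mathbf X^\top\mathbf X)^-\mathbf X^\top\mathbf y$, where $A^-$ is a generalized inverse ($AA^-A=A$). For clients $i,j$ let $\vartheta_i,\vartheta_j$ be their estimators, $\vartheta_{i,j}$ the estimator from their pooled data, and $$s_{ij}=\frac{\|\mathbf X_i(\vartheta_i-\vartheta_{i,j})\|^2+\|\mathbf X_j(\vartheta_j-\vartheta_{i,j})\|^2}{\sigma^2},\qquad df_{ij}=\operatorname{rank}\mathbf X_i+\operatorname{rank}\mathbf X_j-\operatorname{rank}\begin{bmatrix}\mathbf X_i\\ \mathbf X_j\end{bmatrix}.$$ Let $F(\cdot\,;k,\psi)$ be the CDF of the non-central $\chi^2$ law with $k$ degrees of freedom and non-centrality $\psi$ (the point mass at $0$ if $k=0$), and $F^{-1}(p,k,\psi)=\inf\{x: F(x;k,\psi)\ge p\}$. For a threshold $\upsilon^c$ let $\mathcal G$ be the graph on the clients in which $i\ne j$ are joined iff $s_{ij}\le\upsilon^c$, and let $\hat{\mathcal C}$ be the set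 of maximal cliques of $\mathcal G$. **Theorem (Clustering Correctness).** Let $\psi^c=1/\sigma^2$. Suppose that, almost surely, for all $i\neq j$, $$\upsilon^c\ \ge\ F^{-1}\Bigl(1-\frac{\delta}{N^2},\,df_{ij},\,\psi^c\Bigr),$$ and that the exploration phase satisfies $$T_0\ \ge\ \frac{64}{3\lambda_c}\log\frac{2NTd}{\delta}\qquad\text{and, if } M\ge2,\qquad T_0\ \ge\ \frac{16\,\psi^d\sigma^2}{\lambda_c\gamma^2},$$ where $\psi^d=\inf\{\psi\ge0: F(\upsilon^c;d,\psi)\le\frac{\delta}{N^2(M-1)}\}$ is the non-centrality parameter with $F(\upsilon^c;d,\psi^d)=\frac{\delta}{N^2(M-1)}$. Then with probability at least $1-\delta$ we have $\hat{\mathcal C}=\mathcal C$. -/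

import Mathlib

open MeasureTheory ProbabilityTheory Matrix

noncomputable section

namespace HetoFedBandit

/-! ### Non-central chi-squared distribution -/

/-- Non-central `χ²` law with `k` degrees of freedom and non-centrality `ψ ≥ 0`: the law of
`Z₀² + ⋯ + Z_{k-1}²` for independent unit-variance Gaussians with means `√ψ, 0, …, 0`.
For `k = 0` it is the point mass at `0`. -/
def noncentralChiSq (k : ℕ) (ψ : ℝ) : Measure ℝ :=
  (Measure.pi fun i : Fin k => gaussianReal (if (i : ℕ) = 0 then Real.sqrt ψ else 0) 1).map
    (fun z => ∑ i, z i ^ 2)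

/-- The CDF `F(x; k, ψ)` of the non-central `χ²` law. -/
def chiSqCDF (x : ℝ) (k : ℕ) (ψ : ℝ) : ℝ := cdf (noncentralChiSq k ψ) x

/-- `F⁻¹(p, k, ψ)`: the `p`-quantile of the non-central `χ²` law. -/
def chiSqQuantile (p : ℝ) (k : ℕ) (ψ : ℝ) : ℝ := sInf {x : ℝ | p ≤ chiSqCDF x k ψ}

/-- Inverse of the CDF in the non-centrality parameter: the smallest `ψ ≥ 0` with
`F(x; k, ψ) ≤ p` (`F` is continuous and decreasing in `ψ`). -/
def chiSqInvNoncentrality (p : ℝ) (k : ℕ) (x : ℝ) : ℝ :=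
  sInf {ψ : ℝ | 0 ≤ ψ ∧ chiSqCDF x k ψ ≤ p}

/-! ### Homogeneity test -/

/-- Every square real matrix has a generalized inverse. -/
theorem exists_genInverse {d : ℕ} (A : Matrix (Fin d) (Fin d) ℝ) :
    ∃ G : Matrix (Fin d) (Fin d) ℝ, A * G * A = A := by
  obtain ⟨g, hg⟩ := (Matrix.toLin' A).rangeRestrict.exists_rightInverse_of_surjective
    (Matrix.toLin' A).range_rangeRestrict
  obtain ⟨h, hh⟩ := LinearMap.exists_extend g
  refine ⟨LinearMap.toMatrix' h, ?_⟩
  apply Matrix.toLin'.injective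
  rw [Matrix.toLin'_mul, Matrix.toLin'_mul, Matrix.toLin'_toMatrix']
  refine LinearMap.ext fun v => ?_
  have h1 : h (Matrix.toLin' A v) = g ((Matrix.toLin' A).rangeRestrict v) := by
    rw [← hh]; rfl
  have h2 := congrArg Subtype.val (LinearMap.congr_fun hg ((Matrix.toLin' A).rangeRestrict v))
  simp only [LinearMap.comp_apply]
  rw [h1]
  exact h2

/-- A generalized inverse `A⁻`, i.e. a matrix with `A A⁻ A = A`. -/
def genInverse {d : ℕ} (A : Matrix (Fin d) (Fin d) ℝ) : Matrix (Fin d) (Fin d) ℝ :=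
  (exists_genInverse A).choose

/-- The (maximum likelihood) least squares estimator `(Xᵀ X)⁻ Xᵀ y`. -/
def mle {m : Type*} [Fintype m] {d : ℕ} (X : Matrix m (Fin d) ℝ) (y : m → ℝ) : Fin d → ℝ :=
  genInverse (Xᵀ * X) *ᵥ (Xᵀ *ᵥ y)

/-- The homogeneity statistic
`(‖X₁(ϑ₁ - ϑ₁₂)‖² + ‖X₂(ϑ₂ - ϑ₁₂)‖²) / σ²`, where `ϑ₁₂` is the estimator from the pooled data. -/
def homogeneityStat {n d : ℕ} (σ : ℝ) (X₁ : Matrix (Fin n) (Fin d) ℝ) (y₁ : Fin n → ℝ)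
    (X₂ : Matrix (Fin n) (Fin d) ℝ) (y₂ : Fin n → ℝ) : ℝ :=
  let ϑ₁₂ := mle (Matrix.fromRows X₁ X₂) (Sum.elim y₁ y₂)
  let r₁ := X₁ *ᵥ (mle X₁ y₁ - ϑ₁₂)
  let r₂ := X₂ *ᵥ (mle X₂ y₂ - ϑ₁₂)
  (r₁ ⬝ᵥ r₁ + r₂ ⬝ᵥ r₂) / σ ^ 2

/-- Degrees of freedom of the test, `rank X₁ + rank X₂ - rank [X₁; X₂]`
(the natural-number subtraction never truncates). -/
def testDF {n d : ℕ} (X₁ X₂ : Matrix (Fin n) (Fin d) ℝ) : ℕ :=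
  X₁.rank + X₂.rank - (Matrix.fromRows X₁ X₂).rank

/-! ### Cluster estimation -/

/-- The estimated client graph: for every pair `(i, j)` with `s(H_i, H_j) ≤ υ` an undirected edge
is added. -/
def clientGraph {N n d : ℕ} (σ υ : ℝ) (X : Fin N → Matrix (Fin n) (Fin d) ℝ)
    (y : Fin N → Fin n → ℝ) : SimpleGraph (Fin N) :=
  SimpleGraph.fromRel fun i j => homogeneityStat σ (X i) (y i) (X j) (y j) ≤ υ

/-- The set of maximal (with respect to inclusion) cliques of a graph. -/
def maximalCliques {V : Type*} (G : SimpleGraph V) : Set (Finset V) :=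
  {s | Maximal (fun t : Finset V => G.IsClique (t : Set V)) s}

/-- The estimated clusters: the maximal cliques of the estimated client graph. -/
def estimatedClusters {N n d : ℕ} (σ υ : ℝ) (X : Fin N → Matrix (Fin n) (Fin d) ℝ)
    (y : Fin N → Fin n → ℝ) : Set (Finset (Fin N)) :=
  maximalCliques (clientGraph σ υ X y)

/-! ### Environment and pure exploration phase -/

/-- Ground-truth clusters: a partition of the clients such that parameters within a cluster are at
distance at most `1 / (N √T)`, and parameters in distinct clusters at distance at least `γ`. -/
structure IsClusterStructure {N d : ℕ} (T : ℕ) (γ : ℝ) (θ : Fin N → EuclideanSpace ℝ (Fin d))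
    (C : Finpartition (Finset.univ : Finset (Fin N))) : Prop where
  proximity : ∀ c ∈ C.parts, ∀ i ∈ c, ∀ j ∈ c, ‖θ i - θ j‖ ≤ 1 / (N * Real.sqrt T)
  separation : ∀ c ∈ C.parts, ∀ c' ∈ C.parts, c ≠ c' → ∀ i ∈ c, ∀ j ∈ c', γ ≤ ‖θ i - θ j‖

/-- Probabilistic assumptions on the `n` rounds of pure exploration. In round `t`, client `i` is
offered the arms `arm t i k`, `k < K`, plays the arm with index `choice t i`, and the reward is
perturbed by `noise t i`. -/
structure IsExploration {Ω : Type*} [MeasurableSpace Ω] (μ : Measure Ω) {N K d n : ℕ}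
    (σ lamc : ℝ) (arm : Fin n → Fin N → Fin K → Ω → EuclideanSpace ℝ (Fin d))
    (choice : Fin n → Fin N → Ω → Fin K) (noise : Fin n → Fin N → Ω → ℝ) : Prop where
  measurable_arm : ∀ t i k, Measurable (arm t i k)
  measurable_choice : ∀ t i, Measurable (choice t i)
  measurable_noise : ∀ t i, Measurable (noise t i)
  /-- contexts lie in the unit ball -/
  arm_norm_le : ∀ t i k ω, ‖arm t i k ω‖ ≤ 1
  /-- the arms of one arm set are independent -/
  arm_indep : ∀ t i, iIndepFun (fun k => arm t i k) μ
  /-- the arms of one arm set have the same law -/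
  arm_ident : ∀ t i k l, IdentDistrib (arm t i k) (arm t i l) μ μ
  /-- the smallest eigenvalue of `E[x xᵀ]` is at least `lamc` -/
  arm_regular : ∀ t i k (v : EuclideanSpace ℝ (Fin d)),
    lamc * ‖v‖ ^ 2 ≤ ∫ ω, (inner ℝ (arm t i k ω) v) ^ 2 ∂μ
  /-- the index of the played arm is uniform on the arm set -/
  choice_uniform : ∀ t i k, μ.real {ω | choice t i ω = k} = 1 / K
  /-- the index of the played arm is drawn independently of the arm set -/
  choice_indep : ∀ t i, IndepFun (choice t i) (fun ω k => arm t i k ω) μ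
  /-- for every client, arm sets and choices of different rounds are independent -/
  round_indep : ∀ i, iIndepFun (fun t ω => ((fun k => arm t i k ω), choice t i ω)) μ
  /-- the noise is centred Gaussian with variance `σ²` -/
  noise_law : ∀ t i, HasLaw (noise t i) (gaussianReal 0 (Real.toNNReal (σ ^ 2))) μ
  /-- the noise is independent across rounds and clients -/
  noise_indep : iIndepFun (fun (p : Fin n × Fin N) => noise p.1 p.2) μ
  /-- the noise is independent of the arm sets and choices -/
  noise_indep_arm : IndepFun (fun ω (p : Fin n × Fin N) => noise p.1 p.2 ω)
    (fun ω (p : Fin n × Fin N) => ((fun k => arm p.1 p.2 k ω), choice p.1 p.2 ω)) μ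

/-- Design matrix of client `i`: row `t` is the arm played in round `t`. -/
def design {Ω : Type*} {N K d n : ℕ}
    (arm : Fin n → Fin N → Fin K → Ω → EuclideanSpace ℝ (Fin d))
    (choice : Fin n → Fin N → Ω → Fin K) (ω : Ω) (i : Fin N) : Matrix (Fin n) (Fin d) ℝ :=
  Matrix.of fun t a => arm t i (choice t i ω) ω a

/-- Reward vector of client `i`: `y_t = ⟪θ_i, x_t⟫ + η_t`. -/
def reward {Ω : Type*} {N K d n : ℕ} (θ : Fin N → EuclideanSpace ℝ (Fin d))
    (arm : Fin n → Fin N → Fin K → Ω → EuclideanSpace ℝ (Fin d))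
    (choice : Fin n → Fin N → Ω → Fin K) (noise : Fin n → Fin N → Ω → ℝ)
    (ω : Ω) (i : Fin N) : Fin n → ℝ :=
  fun t => inner ℝ (θ i) (arm t i (choice t i ω) ω) + noise t i ω

/-- The length `n` of the exploration phase is sufficient (for `N` clients in `M` clusters, horizon
`T`): `n ≥ 64/(3λ) log(2NTd/δ)` and, if there is more than one cluster,
`n ≥ 16 ψᵈ σ² / (λ γ²)`, where `ψᵈ` solves `F(υ; d, ψᵈ) = δ / (N² (M - 1))`. -/
def LongEnough (n N M T d : ℕ) (σ γ lamc δ υ : ℝ) : Prop :=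
  64 / (3 * lamc) * Real.log (2 * N * T * d / δ) ≤ n ∧
    (2 ≤ M →
      16 * chiSqInvNoncentrality (δ / ((N : ℝ) ^ 2 * ((M : ℝ) - 1))) d υ * σ ^ 2 /
        (lamc * γ ^ 2) ≤ n)

end HetoFedBandit

end

namespace HetoFedBandit

/-! If the test classifies every pair of clients correctly, the graph is the disjoint union of the
complete graphs on the true clusters, and its maximal cliques are those clusters
(`maximalCliques_eq_parts`). The rest is a union bound: at most N²/2 pairs, each failing with
probability at most δ/N², and N designs, each ill conditioned with probability at most δ/(2N).

For fixed designs the statistic is the increase of the residual sum of squares caused by pooling,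
divided by σ². Equivalently, it is the scaled squared norm of the projection of the stacked rewards
onto `testSpace`, of dimension `testDF`. Under Gaussian noise it is therefore non-central χ², its
non-centrality ψ being the statistic of the noiseless rewards (`map_homogeneityStat`). Since the
noise is independent of the designs, Fubini carries conditional bounds over to the random designs.

In one cluster, using θ_j as trial pooled parameter gives ψ ≤ T (1/(N√T))²/σ² ≤ 1/σ², and the χ² CDF
decreases in ψ, so the quantile condition applies. Across clusters, if both Gram matrices exceed
λT₀/8, then the test has d degrees of freedom and ψ > λT₀γ²/(16σ²) ≥ ψᵈ.

The eigenvalue bound uses the potential tr exp(-sG) of the Gram matrix G. Adding x xᵀ with ‖x‖ ≤ 1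
lowers it by at least s(1-s) xᵀ exp(-sG) x (`trace_exp_add_vecMulVec_le`), which follows from a
Duhamel interpolation and Klein's inequality in the two eigenbases. By independence each round
multiplies the expected potential by at most 1 - s(1-s)λ, and Markov's inequality finishes. -/

/-! ### Monotonicity and inversion of the non-central χ² CDF. -/

theorem gaussianPDFReal_sub_le {r y : ℝ} (hr : 0 ≤ r) (hy : y ≤ r) :
    gaussianPDFReal 0 1 (y - 2 * r) ≤ gaussianPDFReal 0 1 y := by
  simp only [gaussianPDFReal_def, NNReal.coe_one, mul_one, sub_zero]
  -- The difference of squares is (y - 2r)² - y² = 4r(r - y).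
  have h := mul_nonneg hr (sub_nonneg.2 hy)
  gcongr ?_ * Real.exp ?_
  nlinarith

/-- The Gaussian mass of a symmetric interval decreases as the mean moves away from `0`. -/
theorem gaussianReal_Icc_antitone {m m' r : ℝ} (hm : 0 ≤ m) (hmm' : m ≤ m') (hr : 0 ≤ r) :
    gaussianReal m' 1 (Set.Icc (-r) r) ≤ gaussianReal m 1 (Set.Icc (-r) r) := by
  have key : ∀ c : ℝ, ∫ x in Set.Icc (-r) r, gaussianPDFReal c 1 x =
      ∫ x in (-r - c)..(r - c), gaussianPDFReal 0 1 x := by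
    intro c
    rw [integral_Icc_eq_integral_Ioc, ← intervalIntegral.integral_of_le (by linarith),
      ← intervalIntegral.integral_comp_sub_right]
    simp [gaussianPDFReal_sub]
  have hint : ∀ a b : ℝ, IntervalIntegrable (gaussianPDFReal 0 1) volume a b := fun a b =>
    (integrable_gaussianPDFReal 0 1).intervalIntegrable
  rw [gaussianReal_apply_eq_integral _ one_ne_zero, gaussianReal_apply_eq_integral _ one_ne_zero]
  refine ENNReal.ofReal_le_ofReal ?_
  rw [key, key]
  -- After centring, moving the mean from m to m' gains the left interval and loses the right one.
  -- They are translates by 2r, and the density is larger on the lost one, which lies below r.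
  have h1 : ∫ x in (-r - m')..(-r - m), gaussianPDFReal 0 1 x
      ≤ ∫ x in (r - m')..(r - m), gaussianPDFReal 0 1 x := by
    have h2 : ∫ x in (r - m')..(r - m), gaussianPDFReal 0 1 (x - 2 * r) =
        ∫ x in (-r - m')..(-r - m), gaussianPDFReal 0 1 x := by
      rw [intervalIntegral.integral_comp_sub_right]
      congr 1 <;> ring
    rw [← h2]
    refine intervalIntegral.integral_mono_on (by linarith) ?_ (hint _ _) fun y hy =>
      gaussianPDFReal_sub_le hr (by linarith [hy.2])
    exact ((integrable_gaussianPDFReal 0 1).comp_sub_right (2 * r)).intervalIntegrable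
  have h3 := intervalIntegral.integral_add_adjacent_intervals
    (hint (-r - m') (-r - m)) (hint (-r - m) (r - m))
  have h4 := intervalIntegral.integral_add_adjacent_intervals
    (hint (-r - m') (r - m')) (hint (r - m') (r - m))
  linarith

theorem setOf_sq_le (a : ℝ) :
    {z : ℝ | z ^ 2 ≤ a} = if 0 ≤ a then Set.Icc (-√a) (√a) else ∅ := by
  ext z
  split_ifs with h
  · simp [Real.sq_le h]
  · simp only [Set.mem_ofPred_eq, Set.mem_empty_iff_false, iff_false, not_le]
    nlinarith [sq_nonneg z]

theorem gaussianReal_sq_le_antitone {m m' : ℝ} (hm : 0 ≤ m) (hmm' : m ≤ m') (a : ℝ) :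
    gaussianReal m' 1 {z | z ^ 2 ≤ a} ≤ gaussianReal m 1 {z | z ^ 2 ≤ a} := by
  rw [setOf_sq_le]
  split_ifs
  · exact gaussianReal_Icc_antitone hm hmm' (Real.sqrt_nonneg a)
  · simp

instance isProbabilityMeasure_noncentralChiSq (k : ℕ) (ψ : ℝ) :
    IsProbabilityMeasure (noncentralChiSq k ψ) :=
  Measure.isProbabilityMeasure_map (Measurable.aemeasurable (by fun_prop))

theorem noncentralChiSq_Iic_zero (ψ ψ' x : ℝ) :
    noncentralChiSq 0 ψ (Set.Iic x) = noncentralChiSq 0 ψ' (Set.Iic x) := by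
  have : (fun i : Fin 0 => gaussianReal (if (i : ℕ) = 0 then √ψ else 0) 1) =
      fun i : Fin 0 => gaussianReal (if (i : ℕ) = 0 then √ψ' else 0) 1 := Subsingleton.elim _ _
  simp only [noncentralChiSq, this]

/-- Only coordinate 0 carries the non-centrality, so Fubini reduces questions about ψ to a single
Gaussian variable. -/
theorem noncentralChiSq_Iic_succ (k : ℕ) (ψ x : ℝ) :
    noncentralChiSq (k + 1) ψ (Set.Iic x) =
      ∫⁻ w, gaussianReal (√ψ) 1 {z | z ^ 2 ≤ x - ∑ i, w i ^ 2}
        ∂(Measure.pi fun _ : Fin k => gaussianReal 0 1) := by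
  have hmp := measurePreserving_piFinSuccAbove
    (fun i : Fin (k + 1) => gaussianReal (if (i : ℕ) = 0 then √ψ else 0) 1) 0
  have hS : MeasurableSet {p : ℝ × (Fin k → ℝ) | p.1 ^ 2 + ∑ i, p.2 i ^ 2 ≤ x} :=
    measurableSet_le (by fun_prop) measurable_const
  rw [noncentralChiSq, Measure.map_apply (by fun_prop) measurableSet_Iic]
  have hpre : (fun z : Fin (k + 1) → ℝ => ∑ i, z i ^ 2) ⁻¹' Set.Iic x =
      (MeasurableEquiv.piFinSuccAbove (fun _ : Fin (k + 1) => ℝ) 0) ⁻¹'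
        {p : ℝ × (Fin k → ℝ) | p.1 ^ 2 + ∑ i, p.2 i ^ 2 ≤ x} := by
    ext z
    simp [Fin.sum_univ_succ, Fin.tail]
  rw [hpre, hmp.measure_preimage hS.nullMeasurableSet, Measure.prod_apply_symm hS]
  simp only [Fin.val_zero, if_true, Fin.zero_succAbove, Fin.val_succ, Nat.succ_ne_zero, if_false]
  refine lintegral_congr fun w => ?_
  congr 1
  ext z
  simp [le_sub_iff_add_le]

theorem noncentralChiSq_Iic_antitone (k : ℕ) {ψ ψ' : ℝ} (h : ψ ≤ ψ') (x : ℝ) :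
    noncentralChiSq k ψ' (Set.Iic x) ≤ noncentralChiSq k ψ (Set.Iic x) := by
  cases k with
  | zero => exact (noncentralChiSq_Iic_zero _ _ _).le
  | succ k =>
    rw [noncentralChiSq_Iic_succ, noncentralChiSq_Iic_succ]
    exact lintegral_mono fun w =>
      gaussianReal_sq_le_antitone (Real.sqrt_nonneg _) (Real.sqrt_le_sqrt h) _

theorem chiSqCDF_eq (x : ℝ) (k : ℕ) (ψ : ℝ) :
    chiSqCDF x k ψ = (noncentralChiSq k ψ).real (Set.Iic x) :=
  cdf_eq_real _ _

theorem ofReal_chiSqCDF (x : ℝ) (k : ℕ) (ψ : ℝ) :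
    ENNReal.ofReal (chiSqCDF x k ψ) = noncentralChiSq k ψ (Set.Iic x) :=
  ofReal_cdf _ _

/-- The CDF of the non-central `χ²` law decreases in the non-centrality parameter. -/
theorem chiSqCDF_antitone (x : ℝ) (k : ℕ) : Antitone (chiSqCDF x k) := fun ψ ψ' h => by
  rw [chiSqCDF_eq, chiSqCDF_eq]
  exact ENNReal.toReal_mono (measure_ne_top _ _) (noncentralChiSq_Iic_antitone k h x)

/-- Right continuity of the CDF makes the infimum in the quantile attained; p < 1 makes its set
nonempty. -/
theorem le_chiSqCDF_of_chiSqQuantile_le {p : ℝ} (hp₁ : p < 1) {k : ℕ} {ψ x : ℝ}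
    (h : chiSqQuantile p k ψ ≤ x) : p ≤ chiSqCDF x k ψ := by
  have hne : {x : ℝ | p ≤ chiSqCDF x k ψ}.Nonempty :=
    ((tendsto_cdf_atTop (noncentralChiSq k ψ)).eventually (eventually_ge_nhds hp₁)).exists
  have hq : ∀ y, x < y → p ≤ chiSqCDF y k ψ := by
    intro y hy
    obtain ⟨z, hz, hzy⟩ := exists_lt_of_csInf_lt hne (h.trans_lt hy)
    exact le_trans hz (monotone_cdf (noncentralChiSq k ψ) hzy.le)
  have hc : Filter.Tendsto (fun y => chiSqCDF y k ψ) (nhdsWithin x (Set.Ioi x))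
      (nhds (chiSqCDF x k ψ)) :=
    ((cdf (noncentralChiSq k ψ)).right_continuous x).tendsto.mono_left
      (nhdsWithin_mono _ Set.Ioi_subset_Ici_self)
  exact ge_of_tendsto hc (Filter.eventually_of_mem self_mem_nhdsWithin hq)

/-- A large mean pushes coordinate 0 beyond √x. This makes the set whose infimum is
`chiSqInvNoncentrality` nonempty; for k = 0 there would be no coordinate to shift. -/
theorem exists_chiSqCDF_le {p : ℝ} (hp : 0 < p) {k : ℕ} (hk : 0 < k) (x : ℝ) :
    ∃ ψ, 0 ≤ ψ ∧ chiSqCDF x k ψ ≤ p := by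
  obtain ⟨k, rfl⟩ := Nat.exists_eq_add_one_of_ne_zero hk.ne'
  obtain ⟨y, hy⟩ := ((tendsto_cdf_atBot (gaussianReal 0 1)).eventually
    (eventually_le_nhds hp)).exists
  -- This shift puts {z² ≤ x} inside {z ≤ y + s}, whose mass under mean s is the standard normal CDF
  -- at y, at most p.
  set s : ℝ := max 0 (√x - y)
  refine ⟨s ^ 2, sq_nonneg s, ?_⟩
  have hs : 0 ≤ s := le_max_left _ _
  have hbound : ∀ w : Fin k → ℝ, gaussianReal (√(s ^ 2)) 1 {z | z ^ 2 ≤ x - ∑ i, w i ^ 2} ≤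
      ENNReal.ofReal p := by
    intro w
    rw [Real.sqrt_sq hs]
    have hsub : {z : ℝ | z ^ 2 ≤ x - ∑ i, w i ^ 2} ⊆ Set.Iic (y + s) := by
      intro z hz
      have h1 : z ^ 2 ≤ x := by
        have : 0 ≤ ∑ i, w i ^ 2 := by positivity
        have := Set.mem_ofPred_eq ▸ hz
        linarith
      have h2 : z ≤ √x := Real.le_sqrt_of_sq_le h1
      have h3 : √x - y ≤ s := le_max_right _ _
      simp only [Set.mem_Iic]
      linarith
    have hmap : gaussianReal s 1 = (gaussianReal 0 1).map (· + s) := by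
      rw [gaussianReal_map_add_const, zero_add]
    calc gaussianReal s 1 {z : ℝ | z ^ 2 ≤ x - ∑ i, w i ^ 2}
        ≤ gaussianReal s 1 (Set.Iic (y + s)) := measure_mono hsub
      _ = gaussianReal 0 1 (Set.Iic y) := by
          rw [hmap, Measure.map_apply (by fun_prop) measurableSet_Iic]
          congr 1
          ext z
          simp
      _ = ENNReal.ofReal (cdf (gaussianReal 0 1) y) := (ofReal_cdf _ _).symm
      _ ≤ ENNReal.ofReal p := ENNReal.ofReal_le_ofReal hy
  have : ENNReal.ofReal (chiSqCDF x (k + 1) (s ^ 2)) ≤ ENNReal.ofReal p := by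
    rw [ofReal_chiSqCDF, noncentralChiSq_Iic_succ]
    refine (lintegral_mono hbound).trans ?_
    simp
  exact (ENNReal.ofReal_le_ofReal_iff hp.le).1 this

/-- With a strict inequality there is an admissible point below ψ, so attainment of the infimum is
not needed. This is why the lower bounds on eigenvalues and non-centrality are kept strict. -/
theorem chiSqCDF_le_of_chiSqInvNoncentrality_lt {p : ℝ} (hp : 0 < p) {k : ℕ} (hk : 0 < k)
    {x ψ : ℝ} (h : chiSqInvNoncentrality p k x < ψ) : chiSqCDF x k ψ ≤ p := by
  obtain ⟨z, hz, hzψ⟩ := exists_lt_of_csInf_lt (exists_chiSqCDF_le hp hk x) h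
  exact (chiSqCDF_antitone x k hzψ.le).trans hz.2

/-! ### Projections of Gaussian vectors. -/

/-- The orthogonal projection of a standard Gaussian vector is standard Gaussian. -/
theorem stdGaussian_map_orthogonalProjection {E : Type*} [NormedAddCommGroup E]
    [InnerProductSpace ℝ E] [FiniteDimensional ℝ E] [MeasurableSpace E] [BorelSpace E]
    (W : Submodule ℝ E) :
    (stdGaussian E).map W.orthogonalProjectionOnto = stdGaussian W := by
  have : IsProbabilityMeasure ((stdGaussian E).map W.orthogonalProjectionOnto) :=
    Measure.isProbabilityMeasure_map (Measurable.aemeasurable (by fun_prop))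
  apply Measure.ext_of_charFun
  ext t
  -- For t in W, ⟨Pw, t⟩ = ⟨w, t⟩, so the characteristic function of the image is the ambient one at
  -- t.
  have h := charFun_stdGaussian (E := E) (t : E)
  rw [charFun_stdGaussian, charFun_apply,
    integral_map (by fun_prop) (by fun_prop)]
  simp only [Submodule.coe_norm]
  rw [← h, charFun_apply]
  simp

/-- Aligning the first basis vector with c turns an arbitrary mean into (‖c‖, 0, …, 0), the one used
in `noncentralChiSq`. -/
theorem exists_orthonormalBasis_smul {k : ℕ} {W : Type*} [NormedAddCommGroup W]
    [InnerProductSpace ℝ W] [FiniteDimensional ℝ W] (hk : Module.finrank ℝ W = k) (c : W) :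
    ∃ b : OrthonormalBasis (Fin k) ℝ W,
      ∀ i, inner ℝ (b i) c = if (i : ℕ) = 0 then ‖c‖ else 0 := by
  by_cases hc : c = 0
  · subst hk
    exact ⟨stdOrthonormalBasis ℝ W, fun i => by simp [hc]⟩
  have hnc : ‖c‖ ≠ 0 := norm_ne_zero_iff.2 hc
  have : Nontrivial W := ⟨c, 0, hc⟩
  have hk0 : 0 < k := hk ▸ Module.finrank_pos
  have : NeZero k := ⟨hk0.ne'⟩
  obtain ⟨b, hb⟩ := Orthonormal.exists_orthonormalBasis_extension_of_card_eq (𝕜 := ℝ)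
    (ι := Fin k) (by simpa using hk) (v := fun _ => ‖c‖⁻¹ • c) (s := {0}) (by
      rw [orthonormal_iff_ite]
      intro i j
      have : i = j := Subsingleton.elim _ _
      simp only [this, if_true, Set.domRestrict_apply]
      rw [real_inner_smul_left, real_inner_smul_right, real_inner_self_eq_norm_sq]
      field_simp)
  refine ⟨b, fun i => ?_⟩
  have hc' : c = ‖c‖ • b 0 := by
    rw [hb 0 (Set.mem_singleton _), smul_smul, mul_inv_cancel₀ hnc, one_smul]
  have h1 : inner ℝ (b i) c = ‖c‖ * inner ℝ (b i) (b 0) := by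
    conv_lhs => rw [hc']
    rw [real_inner_smul_right]
  rw [h1, b.inner_eq_ite]
  by_cases hi : i = 0
  · simp [hi]
  · have : (i : ℕ) ≠ 0 := fun h => hi (Fin.ext (by simpa using h))
    simp [hi, this]

theorem stdGaussian_map_norm_add_sq {k : ℕ} {W : Type*} [NormedAddCommGroup W]
    [InnerProductSpace ℝ W] [FiniteDimensional ℝ W] [MeasurableSpace W] [BorelSpace W]
    (hk : Module.finrank ℝ W = k) (c : W) :
    (stdGaussian W).map (fun w => ‖c + w‖ ^ 2) = noncentralChiSq k (‖c‖ ^ 2) := by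
  obtain ⟨b, hb⟩ := exists_orthonormalBasis_smul hk c
  rw [stdGaussian_eq_map_pi_orthonormalBasis b, Measure.map_map (by fun_prop) (by fun_prop),
    noncentralChiSq, Real.sqrt_sq (norm_nonneg c)]
  have hpi : (Measure.pi fun i : Fin k => gaussianReal (if (i : ℕ) = 0 then ‖c‖ else 0) 1) =
      (Measure.pi fun _ : Fin k => gaussianReal 0 1).map
        (fun x (i : Fin k) => (if (i : ℕ) = 0 then ‖c‖ else 0) + x i) := by
    rw [Measure.pi_map_pi (f := fun (i : Fin k) y => (if (i : ℕ) = 0 then ‖c‖ else 0) + y)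
      (fun i => by fun_prop)]
    congr 1
    ext1 i
    rw [gaussianReal_map_const_add, zero_add]
  rw [hpi, Measure.map_map (by fun_prop) (by fun_prop)]
  congr 1
  ext x
  simp only [Function.comp_apply]
  rw [← b.sum_sq_inner_right]
  refine Finset.sum_congr rfl fun i _ => ?_
  rw [inner_add_right, hb, b.orthonormal.inner_right_fintype]

/-- The squared norm of the projection of a Gaussian vector on a subspace is non-central `χ²`. -/
theorem map_norm_orthogonalProjection_sq {ι : Type*} [Fintype ι] {σ : ℝ} (hσ : 0 < σ)
    (W : Submodule ℝ (EuclideanSpace ℝ ι)) (m : ι → ℝ) :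
    (Measure.pi fun _ : ι => gaussianReal 0 (Real.toNNReal (σ ^ 2))).map
        (fun η => ‖W.orthogonalProjectionOnto (WithLp.toLp 2 (m + η))‖ ^ 2 / σ ^ 2) =
      noncentralChiSq (Module.finrank ℝ W)
        (‖W.orthogonalProjectionOnto (WithLp.toLp 2 m)‖ ^ 2 / σ ^ 2) := by
  classical
  have hpi : (Measure.pi fun _ : ι => gaussianReal 0 (Real.toNNReal (σ ^ 2))) =
      (Measure.pi fun _ : ι => gaussianReal 0 1).map (fun x i => σ * x i) := by
    rw [Measure.pi_map_pi (f := fun _ y => σ * y) (fun i => by fun_prop)]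
    congr 1
    ext1 i
    rw [gaussianReal_map_const_mul, mul_zero, mul_one]
    congr 1
    ext
    simp [sq_nonneg]
  have hc : ‖W.orthogonalProjectionOnto (WithLp.toLp 2 m)‖ ^ 2 / σ ^ 2 =
      ‖σ⁻¹ • W.orthogonalProjectionOnto (WithLp.toLp 2 m)‖ ^ 2 := by
    rw [norm_smul, mul_pow, norm_inv, Real.norm_of_nonneg hσ.le, inv_pow]
    ring
  rw [hc, ← stdGaussian_map_norm_add_sq rfl, ← stdGaussian_map_orthogonalProjection,
    ← map_pi_eq_stdGaussian, Measure.map_map (by fun_prop) (by fun_prop),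
    Measure.map_map (by fun_prop) (by fun_prop), hpi, Measure.map_map (by fun_prop) (by fun_prop)]
  congr 1
  ext x
  simp only [Function.comp_apply]
  have h1 : (WithLp.toLp 2 (m + fun i => σ * x i) : EuclideanSpace ℝ ι) =
      WithLp.toLp 2 m + σ • WithLp.toLp 2 x := by
    ext i
    simp
  have h2 : W.orthogonalProjectionOnto (WithLp.toLp 2 m + σ • WithLp.toLp 2 x) =
      σ • (σ⁻¹ • W.orthogonalProjectionOnto (WithLp.toLp 2 m) +
        W.orthogonalProjectionOnto (WithLp.toLp 2 x)) := by
    rw [map_add, map_smul, smul_add, smul_smul, mul_inv_cancel₀ hσ.ne', one_smul]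
  rw [h1, h2, norm_smul, mul_pow, Real.norm_of_nonneg hσ.le]
  field_simp

/-! ### Least squares and the normal equations. -/

section LeastSquares

variable {m : Type*} [Fintype m] {d : ℕ}

/-- These normal equations hold for any generalized inverse G: Z = (XᵀXG - 1)Xᵀ satisfies ZX = 0,
hence ZZᵀ = 0 and Z = 0. -/
theorem transpose_mulVec_mulVec_mle (X : Matrix m (Fin d) ℝ) (y : m → ℝ) :
    Xᵀ *ᵥ (X *ᵥ mle X y) = Xᵀ *ᵥ y := by
  have hG : (Xᵀ * X) * genInverse (Xᵀ * X) * (Xᵀ * X) = Xᵀ * X :=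
    (exists_genInverse (Xᵀ * X)).choose_spec
  set G := genInverse (Xᵀ * X) with hGdef
  have hZ : ((Xᵀ * X * G - 1) * Xᵀ) * X = 0 := by
    rw [Matrix.mul_assoc, Matrix.sub_mul, hG, Matrix.one_mul, sub_self]
  have hZ0 : (Xᵀ * X * G - 1) * Xᵀ = 0 := by
    rw [← Matrix.self_mul_conjTranspose_eq_zero, Matrix.conjTranspose_eq_transpose_of_trivial]
    conv_lhs => rw [Matrix.transpose_mul, Matrix.transpose_transpose, ← Matrix.mul_assoc]
    rw [hZ, Matrix.zero_mul]
  have h : Xᵀ * X * G * Xᵀ = Xᵀ := by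
    rwa [Matrix.sub_mul, Matrix.one_mul, sub_eq_zero] at hZ0
  rw [mle, ← hGdef, Matrix.mulVec_mulVec, Matrix.mulVec_mulVec, Matrix.mulVec_mulVec, h]

theorem mulVec_dotProduct_mulVec_mle (X : Matrix m (Fin d) ℝ) (y : m → ℝ) (β : Fin d → ℝ) :
    (X *ᵥ β) ⬝ᵥ (X *ᵥ mle X y) = (X *ᵥ β) ⬝ᵥ y := by
  have key : ∀ w : m → ℝ, (X *ᵥ β) ⬝ᵥ w = β ⬝ᵥ (Xᵀ *ᵥ w) := fun w => by
    rw [Matrix.dotProduct_mulVec, Matrix.vecMul_transpose]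
  rw [key, key, transpose_mulVec_mulVec_mle]

/-- Pythagoras: the residual of the fit is orthogonal to the column space. -/
theorem sub_mulVec_dotProduct_self (X : Matrix m (Fin d) ℝ) (y : m → ℝ) (β : Fin d → ℝ) :
    (y - X *ᵥ β) ⬝ᵥ (y - X *ᵥ β) = (y - X *ᵥ mle X y) ⬝ᵥ (y - X *ᵥ mle X y) +
      (X *ᵥ (mle X y - β)) ⬝ᵥ (X *ᵥ (mle X y - β)) := by
  have h1 := mulVec_dotProduct_mulVec_mle X y β
  have h2 := mulVec_dotProduct_mulVec_mle X y (mle X y)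
  simp only [Matrix.mulVec_sub, sub_dotProduct, dotProduct_sub]
  rw [dotProduct_comm y (X *ᵥ β), dotProduct_comm y (X *ᵥ mle X y),
    dotProduct_comm (X *ᵥ mle X y) (X *ᵥ β), h1, h2]
  ring

/-- The residual sum of squares of the least squares fit. -/
noncomputable def leastSq (X : Matrix m (Fin d) ℝ) (y : m → ℝ) : ℝ :=
  ⨅ β : Fin d → ℝ, (y - X *ᵥ β) ⬝ᵥ (y - X *ᵥ β)

theorem real_dotProduct_self_nonneg (v : m → ℝ) : 0 ≤ v ⬝ᵥ v :=
  Finset.sum_nonneg fun i _ => mul_self_nonneg (v i)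

theorem bddBelow_range_leastSq (X : Matrix m (Fin d) ℝ) (y : m → ℝ) :
    BddBelow (Set.range fun β : Fin d → ℝ => (y - X *ᵥ β) ⬝ᵥ (y - X *ᵥ β)) :=
  ⟨0, by rintro _ ⟨β, rfl⟩; exact real_dotProduct_self_nonneg _⟩

theorem leastSq_le (X : Matrix m (Fin d) ℝ) (y : m → ℝ) (β : Fin d → ℝ) :
    leastSq X y ≤ (y - X *ᵥ β) ⬝ᵥ (y - X *ᵥ β) :=
  ciInf_le (bddBelow_range_leastSq X y) β

/-- By Pythagoras the infimum is attained at the estimator. The infimum form does not mention the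
chosen generalized inverse, and any trial β bounds it from above. -/
theorem leastSq_eq (X : Matrix m (Fin d) ℝ) (y : m → ℝ) :
    leastSq X y = (y - X *ᵥ mle X y) ⬝ᵥ (y - X *ᵥ mle X y) := by
  refine le_antisymm (leastSq_le X y _) (le_ciInf fun β => ?_)
  rw [sub_mulVec_dotProduct_self X y β]
  linarith [real_dotProduct_self_nonneg (X *ᵥ (mle X y - β))]

theorem leastSq_nonneg (X : Matrix m (Fin d) ℝ) (y : m → ℝ) : 0 ≤ leastSq X y :=
  leastSq_eq X y ▸ real_dotProduct_self_nonneg _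

theorem leastSq_mulVec (X : Matrix m (Fin d) ℝ) (θ : Fin d → ℝ) : leastSq X (X *ᵥ θ) = 0 :=
  le_antisymm ((leastSq_le X _ θ).trans (by simp)) (leastSq_nonneg _ _)

/-- An infimum of continuous functions is upper semicontinuous. This avoids asking whether
`genInverse`, obtained by choice, is measurable. -/
theorem measurable_leastSq {α : Type*} [TopologicalSpace α] [MeasurableSpace α]
    [OpensMeasurableSpace α] {X : α → Matrix m (Fin d) ℝ} {y : α → m → ℝ}
    (hX : Continuous X) (hy : Continuous y) : Measurable fun a => leastSq (X a) (y a) := by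
  refine UpperSemicontinuous.measurable (upperSemicontinuous_ciInf
    (fun a => bddBelow_range_leastSq _ _) fun β => Continuous.upperSemicontinuous ?_)
  have h : Continuous fun a => y a - X a *ᵥ β := hy.sub (hX.matrix_mulVec continuous_const)
  exact h.dotProduct h

end LeastSquares

/-! ### The homogeneity statistic for fixed designs. -/

variable {n d : ℕ}

theorem sumElim_dotProduct_self (X₁ X₂ : Matrix (Fin n) (Fin d) ℝ) (y₁ y₂ : Fin n → ℝ)
    (β : Fin d → ℝ) :
    (Sum.elim y₁ y₂ - fromRows X₁ X₂ *ᵥ β) ⬝ᵥ (Sum.elim y₁ y₂ - fromRows X₁ X₂ *ᵥ β) =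
      (y₁ - X₁ *ᵥ β) ⬝ᵥ (y₁ - X₁ *ᵥ β) + (y₂ - X₂ *ᵥ β) ⬝ᵥ (y₂ - X₂ *ᵥ β) := by
  simp [dotProduct, Fintype.sum_sum_type, fromRows_mulVec]

theorem leastSq_fromRows_comm (X₁ X₂ : Matrix (Fin n) (Fin d) ℝ) (y₁ y₂ : Fin n → ℝ) :
    leastSq (fromRows X₁ X₂) (Sum.elim y₁ y₂) = leastSq (fromRows X₂ X₁) (Sum.elim y₂ y₁) := by
  simp only [leastSq, sumElim_dotProduct_self]
  exact iInf_congr fun β => add_comm _ _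

/-- Pythagoras for each client, applied at the pooled estimator. Symmetry, measurability and
independence of the choice of generalized inverse all become visible. -/
theorem homogeneityStat_eq_leastSq (σ : ℝ) (X₁ : Matrix (Fin n) (Fin d) ℝ) (y₁ : Fin n → ℝ)
    (X₂ : Matrix (Fin n) (Fin d) ℝ) (y₂ : Fin n → ℝ) :
    homogeneityStat σ X₁ y₁ X₂ y₂ = (leastSq (fromRows X₁ X₂) (Sum.elim y₁ y₂) - leastSq X₁ y₁ -
      leastSq X₂ y₂) / σ ^ 2 := by
  rw [leastSq_eq (fromRows X₁ X₂), sumElim_dotProduct_self, sub_mulVec_dotProduct_self X₁,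
    sub_mulVec_dotProduct_self X₂, leastSq_eq X₁, leastSq_eq X₂, homogeneityStat]
  ring_nf

theorem homogeneityStat_comm (σ : ℝ) (X₁ : Matrix (Fin n) (Fin d) ℝ) (y₁ : Fin n → ℝ)
    (X₂ : Matrix (Fin n) (Fin d) ℝ) (y₂ : Fin n → ℝ) :
    homogeneityStat σ X₁ y₁ X₂ y₂ = homogeneityStat σ X₂ y₂ X₁ y₁ := by
  rw [homogeneityStat_eq_leastSq, homogeneityStat_eq_leastSq, leastSq_fromRows_comm]
  ring

theorem homogeneityStat_mulVec (σ : ℝ) (X₁ X₂ : Matrix (Fin n) (Fin d) ℝ) (θ₁ θ₂ : Fin d → ℝ) :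
    homogeneityStat σ X₁ (X₁ *ᵥ θ₁) X₂ (X₂ *ᵥ θ₂) =
      leastSq (fromRows X₁ X₂) (Sum.elim (X₁ *ᵥ θ₁) (X₂ *ᵥ θ₂)) / σ ^ 2 := by
  rw [homogeneityStat_eq_leastSq, leastSq_mulVec, leastSq_mulVec, sub_zero, sub_zero]

/-- Taking θ₂ as trial pooled parameter leaves only the residual of the first client. -/
theorem homogeneityStat_mulVec_le (σ : ℝ) (X₁ X₂ : Matrix (Fin n) (Fin d) ℝ)
    (θ₁ θ₂ : Fin d → ℝ) :
    homogeneityStat σ X₁ (X₁ *ᵥ θ₁) X₂ (X₂ *ᵥ θ₂) ≤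
      (X₁ *ᵥ (θ₁ - θ₂)) ⬝ᵥ (X₁ *ᵥ (θ₁ - θ₂)) / σ ^ 2 := by
  rw [homogeneityStat_mulVec]
  gcongr
  refine (leastSq_le _ _ θ₂).trans ?_
  rw [sumElim_dotProduct_self, Matrix.mulVec_sub]
  simp

/-- The pooled estimate β cannot be close to both parameters: ‖θ₁ - θ₂‖² ≤ 2(‖θ₁ - β‖² + ‖θ₂ - β‖²).
Strictness survives because β differs from at least one of them. -/
theorem lt_homogeneityStat_mulVec {σ c : ℝ} (hσ : 0 < σ) (hc : 0 ≤ c)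
    {X₁ X₂ : Matrix (Fin n) (Fin d) ℝ}
    (h₁ : ∀ v, v ≠ 0 → c * (v ⬝ᵥ v) < (X₁ *ᵥ v) ⬝ᵥ (X₁ *ᵥ v))
    (h₂ : ∀ v, v ≠ 0 → c * (v ⬝ᵥ v) < (X₂ *ᵥ v) ⬝ᵥ (X₂ *ᵥ v))
    {θ₁ θ₂ : Fin d → ℝ} (hθ : θ₁ ≠ θ₂) :
    c * ((θ₁ - θ₂) ⬝ᵥ (θ₁ - θ₂)) / (2 * σ ^ 2) <
      homogeneityStat σ X₁ (X₁ *ᵥ θ₁) X₂ (X₂ *ᵥ θ₂) := by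
  rw [homogeneityStat_mulVec, ← div_div]
  gcongr
  rw [leastSq_eq, sumElim_dotProduct_self, ← Matrix.mulVec_sub, ← Matrix.mulVec_sub]
  set β := mle (fromRows X₁ X₂) (Sum.elim (X₁ *ᵥ θ₁) (X₂ *ᵥ θ₂))
  have hle : ∀ {X : Matrix (Fin n) (Fin d) ℝ}, (∀ v, v ≠ 0 → c * (v ⬝ᵥ v) <
      (X *ᵥ v) ⬝ᵥ (X *ᵥ v)) → ∀ v, c * (v ⬝ᵥ v) ≤ (X *ᵥ v) ⬝ᵥ (X *ᵥ v) := by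
    intro X h v
    by_cases hv : v = 0
    · simp [hv]
    · exact (h v hv).le
  have hsq : (θ₁ - θ₂) ⬝ᵥ (θ₁ - θ₂) ≤
      2 * ((θ₁ - β) ⬝ᵥ (θ₁ - β) + (θ₂ - β) ⬝ᵥ (θ₂ - β)) := by
    simp only [dotProduct, ← Finset.sum_add_distrib, Finset.mul_sum, Pi.sub_apply]
    exact Finset.sum_le_sum fun i _ => by nlinarith [sq_nonneg (θ₁ i - β i + (θ₂ i - β i))]
  have hstrict : c * ((θ₁ - β) ⬝ᵥ (θ₁ - β)) + c * ((θ₂ - β) ⬝ᵥ (θ₂ - β)) <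
      (X₁ *ᵥ (θ₁ - β)) ⬝ᵥ (X₁ *ᵥ (θ₁ - β)) + (X₂ *ᵥ (θ₂ - β)) ⬝ᵥ (X₂ *ᵥ (θ₂ - β)) := by
    by_cases h : θ₁ - β = 0
    · have h' : θ₂ - β ≠ 0 := fun h' => hθ ((sub_eq_zero.1 h).trans (sub_eq_zero.1 h').symm)
      exact add_lt_add_of_le_of_lt (hle h₁ _) (h₂ _ h')
    · exact add_lt_add_of_lt_of_le (h₁ _ h) (hle h₂ _)
  nlinarith [mul_le_mul_of_nonneg_left hsq hc]

/-- `β ↦ X β` as a linear map to a Euclidean space. -/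
noncomputable def euclideanMulVec {m p : Type*} [Fintype m] [Fintype p] (X : Matrix m p ℝ) :
    (p → ℝ) →ₗ[ℝ] EuclideanSpace ℝ m :=
  (WithLp.linearEquiv 2 ℝ (m → ℝ)).symm.toLinearMap ∘ₗ X.mulVecLin

theorem euclideanMulVec_apply {m p : Type*} [Fintype m] [Fintype p] (X : Matrix m p ℝ)
    (v : p → ℝ) : euclideanMulVec X v = WithLp.toLp 2 (X *ᵥ v) := rfl

theorem finrank_range_euclideanMulVec {m p : Type*} [Fintype m] [Fintype p] (X : Matrix m p ℝ) :
    Module.finrank ℝ (euclideanMulVec X).range = X.rank := by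
  rw [euclideanMulVec, LinearMap.range_comp, Matrix.rank]
  exact LinearEquiv.finrank_map_eq (WithLp.linearEquiv 2 ℝ (m → ℝ)).symm _

theorem rank_fromBlocks_zero_zero (X₁ X₂ : Matrix (Fin n) (Fin d) ℝ) :
    (fromBlocks X₁ 0 0 X₂).rank = X₁.rank + X₂.rank := by
  let φ : X₁.mulVecLin.range × X₂.mulVecLin.range →ₗ[ℝ] (Fin n ⊕ Fin n → ℝ) :=
    (LinearEquiv.sumArrowLequivProdArrow (Fin n) (Fin n) ℝ ℝ).symm.toLinearMap ∘ₗ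
      X₁.mulVecLin.range.subtype.prodMap X₂.mulVecLin.range.subtype
  have hφ : Function.Injective φ :=
    (LinearEquiv.sumArrowLequivProdArrow (Fin n) (Fin n) ℝ ℝ).symm.injective.comp
      (Subtype.val_injective.prodMap Subtype.val_injective)
  have hrange : (fromBlocks X₁ 0 0 X₂).mulVecLin.range = φ.range := by
    refine le_antisymm ?_ ?_
    · rintro _ ⟨v, rfl⟩
      refine ⟨(⟨X₁ *ᵥ (v ∘ Sum.inl), ⟨_, rfl⟩⟩, ⟨X₂ *ᵥ (v ∘ Sum.inr), ⟨_, rfl⟩⟩), ?_⟩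
      ext (i | i) <;> simp [φ, fromBlocks_mulVec]
    · rintro _ ⟨⟨⟨_, ⟨a, rfl⟩⟩, ⟨_, ⟨b, rfl⟩⟩⟩, rfl⟩
      refine ⟨Sum.elim a b, ?_⟩
      ext (i | i) <;> simp [φ, fromBlocks_mulVec]
  rw [Matrix.rank, hrange, LinearMap.finrank_range_of_inj hφ, Module.finrank_prod,
    Matrix.rank, Matrix.rank]

/-- The subspace on which the homogeneity test projects the pooled rewards: the orthogonal
complement of the pooled column space in the sum of the column spaces of both clients. -/
noncomputable def testSpace (X₁ X₂ : Matrix (Fin n) (Fin d) ℝ) :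
    Submodule ℝ (EuclideanSpace ℝ (Fin n ⊕ Fin n)) :=
  (euclideanMulVec (fromRows X₁ X₂)).rangeᗮ ⊓ (euclideanMulVec (fromBlocks X₁ 0 0 X₂)).range

/-- The pooled column space lies in the block diagonal one (repeat β), so the dimension of its
relative complement is the difference of ranks. In particular the subtraction in `testDF` does not
truncate. -/
theorem finrank_testSpace (X₁ X₂ : Matrix (Fin n) (Fin d) ℝ) :
    Module.finrank ℝ (testSpace X₁ X₂) = testDF X₁ X₂ := by
  have hle : (euclideanMulVec (fromRows X₁ X₂)).range ≤
      (euclideanMulVec (fromBlocks X₁ 0 0 X₂)).range := by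
    rintro _ ⟨β, rfl⟩
    refine ⟨Sum.elim β β, ?_⟩
    simp [euclideanMulVec_apply, fromBlocks_mulVec, fromRows_mulVec]
  have h := Submodule.finrank_add_inf_finrank_orthogonal hle
  rw [finrank_range_euclideanMulVec, finrank_range_euclideanMulVec,
    rank_fromBlocks_zero_zero] at h
  rw [testDF, testSpace]
  omega

theorem inner_toLp_sumElim (a b a' b' : Fin n → ℝ) :
    inner ℝ (WithLp.toLp 2 (Sum.elim a b) : EuclideanSpace ℝ (Fin n ⊕ Fin n))
      (WithLp.toLp 2 (Sum.elim a' b')) = a' ⬝ᵥ a + b' ⬝ᵥ b := by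
  simp [PiLp.inner_apply, Fintype.sum_sum_type, dotProduct]

/-- The stacked vector (r₁, r₂) is the projection. It is a difference of block fits, orthogonal to
the pooled columns by the normal equations; what remains of the rewards is the separate residuals
plus the pooled fit, both orthogonal to `testSpace`. -/
theorem homogeneityStat_eq_norm_sq (σ : ℝ) (X₁ : Matrix (Fin n) (Fin d) ℝ) (y₁ : Fin n → ℝ)
    (X₂ : Matrix (Fin n) (Fin d) ℝ) (y₂ : Fin n → ℝ) :
    homogeneityStat σ X₁ y₁ X₂ y₂ =
      ‖(testSpace X₁ X₂).orthogonalProjectionOnto (WithLp.toLp 2 (Sum.elim y₁ y₂))‖ ^ 2 /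
        σ ^ 2 := by
  set ϑ := mle (fromRows X₁ X₂) (Sum.elim y₁ y₂) with hϑ
  set r₁ := X₁ *ᵥ (mle X₁ y₁ - ϑ) with hr₁
  set r₂ := X₂ *ᵥ (mle X₂ y₂ - ϑ) with hr₂
  have hpool : ∀ β : Fin d → ℝ, (X₁ *ᵥ β) ⬝ᵥ (X₁ *ᵥ ϑ) + (X₂ *ᵥ β) ⬝ᵥ (X₂ *ᵥ ϑ) =
      (X₁ *ᵥ β) ⬝ᵥ y₁ + (X₂ *ᵥ β) ⬝ᵥ y₂ := by
    intro β
    have h := mulVec_dotProduct_mulVec_mle (fromRows X₁ X₂) (Sum.elim y₁ y₂) β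
    rw [← hϑ] at h
    simpa [fromRows_mulVec, sumElim_dotProduct_sumElim] using h
  have hmem : (WithLp.toLp 2 (Sum.elim r₁ r₂) : EuclideanSpace ℝ (Fin n ⊕ Fin n)) ∈
      testSpace X₁ X₂ := by
    refine ⟨?_, ⟨Sum.elim (mle X₁ y₁ - ϑ) (mle X₂ y₂ - ϑ), ?_⟩⟩
    · rw [SetLike.mem_coe, Submodule.mem_orthogonal]
      rintro _ ⟨β, rfl⟩
      rw [euclideanMulVec_apply, fromRows_mulVec, real_inner_comm, inner_toLp_sumElim, hr₁, hr₂,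
        Matrix.mulVec_sub, Matrix.mulVec_sub, dotProduct_sub, dotProduct_sub,
        mulVec_dotProduct_mulVec_mle, mulVec_dotProduct_mulVec_mle]
      linarith [hpool β]
    · simp [euclideanMulVec_apply, fromBlocks_mulVec, hr₁, hr₂]
  have hproj : (testSpace X₁ X₂).starProjection (WithLp.toLp 2 (Sum.elim y₁ y₂)) =
      WithLp.toLp 2 (Sum.elim r₁ r₂) := by
    refine Submodule.eq_starProjection_of_mem_of_inner_eq_zero hmem ?_
    rintro _ ⟨hw, ⟨v, rfl⟩⟩
    have hw' := (Submodule.mem_orthogonal _ _).1 hw _ ⟨ϑ, rfl⟩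
    rw [euclideanMulVec_apply, euclideanMulVec_apply, fromRows_mulVec, fromBlocks_mulVec,
      inner_toLp_sumElim] at hw'
    rw [euclideanMulVec_apply, fromBlocks_mulVec, inner_sub_left, inner_toLp_sumElim,
      inner_toLp_sumElim, hr₁, hr₂]
    simp only [Matrix.zero_mulVec, add_zero, zero_add] at hw' ⊢
    rw [Matrix.mulVec_sub, Matrix.mulVec_sub, dotProduct_sub, dotProduct_sub,
      mulVec_dotProduct_mulVec_mle, mulVec_dotProduct_mulVec_mle]
    linarith
  have hnorm : ‖(testSpace X₁ X₂).orthogonalProjectionOnto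
      (WithLp.toLp 2 (Sum.elim y₁ y₂))‖ ^ 2 = r₁ ⬝ᵥ r₁ + r₂ ⬝ᵥ r₂ := by
    rw [← inner_toLp_sumElim, ← hproj, real_inner_self_eq_norm_sq, Submodule.starProjection_apply,
      Submodule.coe_norm]
  rw [hnorm, homogeneityStat]

/-- With a fixed design and Gaussian noise the homogeneity statistic is non-central `χ²`. -/
theorem map_homogeneityStat {σ : ℝ} (hσ : 0 < σ) (X₁ X₂ : Matrix (Fin n) (Fin d) ℝ)
    (m₁ m₂ : Fin n → ℝ) :
    (Measure.pi fun _ : Fin n ⊕ Fin n => gaussianReal 0 (Real.toNNReal (σ ^ 2))).map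
        (fun η => homogeneityStat σ X₁ (m₁ + η ∘ Sum.inl) X₂ (m₂ + η ∘ Sum.inr)) =
      noncentralChiSq (testDF X₁ X₂) (homogeneityStat σ X₁ m₁ X₂ m₂) := by
  rw [homogeneityStat_eq_norm_sq, ← finrank_testSpace,
    ← map_norm_orthogonalProjection_sq hσ]
  congr 1
  ext η
  rw [homogeneityStat_eq_norm_sq]
  congr 4
  ext (i | i) <;> simp

theorem measurable_homogeneityStat {α : Type*} [TopologicalSpace α] [MeasurableSpace α]
    [OpensMeasurableSpace α] (σ : ℝ) {X₁ X₂ : α → Matrix (Fin n) (Fin d) ℝ}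
    {y₁ y₂ : α → Fin n → ℝ} (hX₁ : Continuous X₁) (hX₂ : Continuous X₂) (hy₁ : Continuous y₁)
    (hy₂ : Continuous y₂) :
    Measurable fun a => homogeneityStat σ (X₁ a) (y₁ a) (X₂ a) (y₂ a) := by
  simp only [homogeneityStat_eq_leastSq]
  refine Measurable.div_const (Measurable.sub (Measurable.sub ?_ (measurable_leastSq hX₁ hy₁))
    (measurable_leastSq hX₂ hy₂)) _
  refine measurable_leastSq ?_ ?_
  · refine continuous_matrix ?_
    rintro (i | i) j
    · exact hX₁.matrix_elem i j
    · exact hX₂.matrix_elem i j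
  · refine continuous_pi ?_
    rintro (i | i)
    · exact (continuous_apply i).comp hy₁
    · exact (continuous_apply i).comp hy₂

/-! ### Exponential sums over the spectra of a rank one perturbation. -/

section RankOneSpectra

variable {ι : Type*} [Fintype ι]

/-- The function `τ ↦ ∑ e^{-τ aᵢ} wᵢ` with `w ≥ 0` is log-convex. -/
theorem sum_exp_mul_sum_exp_le (a w : ι → ℝ) (hw : ∀ i, 0 ≤ w i) {s u : ℝ} (hu : 0 ≤ u)
    (hus : u ≤ s) :
    (∑ i, Real.exp (-(s - u) * a i) * w i) * (∑ i, Real.exp (-u * a i) * w i) ≤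
      (∑ i, w i) * ∑ i, Real.exp (-s * a i) * w i := by
  have hterm : ∀ i j, Real.exp (-(s - u) * a i) * w i * (Real.exp (-u * a j) * w j) +
      Real.exp (-(s - u) * a j) * w j * (Real.exp (-u * a i) * w i) ≤
      w i * (Real.exp (-s * a j) * w j) + w j * (Real.exp (-s * a i) * w i) := by
    intro i j
    have hs : ∀ k, Real.exp (-s * a k) = Real.exp (-(s - u) * a k) * Real.exp (-u * a k) :=
      fun k => by rw [← Real.exp_add]; ring_nf
    -- Chebyshev's argument: both exponentials decrease in the value of a.
    have hprod : 0 ≤ (Real.exp (-(s - u) * a i) - Real.exp (-(s - u) * a j)) *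
        (Real.exp (-u * a i) - Real.exp (-u * a j)) := by
      rcases le_total (a i) (a j) with h | h
      · apply mul_nonneg <;> rw [sub_nonneg, Real.exp_le_exp] <;> nlinarith
      · apply mul_nonneg_of_nonpos_of_nonpos <;> rw [sub_nonpos, Real.exp_le_exp] <;> nlinarith
    rw [hs, hs]
    nlinarith [mul_nonneg (mul_nonneg (hw i) (hw j)) hprod]
  have hsum := Finset.sum_le_sum fun i (_ : i ∈ Finset.univ) =>
    Finset.sum_le_sum fun j (_ : j ∈ Finset.univ) => hterm i j
  simp only [Finset.sum_add_distrib] at hsum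
  have hcomm : ∀ F : ι → ι → ℝ, ∑ i, ∑ j, F j i = ∑ i, ∑ j, F i j := fun F => Finset.sum_comm
  rw [hcomm fun i j => Real.exp (-(s - u) * a i) * w i * (Real.exp (-u * a j) * w j),
    hcomm fun i j => w i * (Real.exp (-s * a j) * w j)] at hsum
  rw [Finset.sum_mul_sum, Finset.sum_mul_sum]
  linarith

variable {a b p q : ι → ℝ} {O : ι → ι → ℝ}

/-- Think of a, b as the spectra of A and B = A + x xᵀ, of O as the overlaps of their eigenbases,
and of p, q as the coordinates of x. Then `hO` is A - B = -x xᵀ in mixed coordinates, and the double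
sum is the Duhamel interpolation xᵀ exp(-(s-u)A) exp(-uB) x, whose derivative factorizes. -/
theorem hasDerivAt_rankOne (hO : ∀ i j, (a i - b j) * O i j = -(p i * q j)) (s u : ℝ) :
    HasDerivAt (fun u => ∑ i, ∑ j, Real.exp (-(s - u) * a i - u * b j) * (p i * O i j * q j))
      (-((∑ i, Real.exp (-(s - u) * a i) * p i ^ 2) * ∑ j, Real.exp (-u * b j) * q j ^ 2)) u := by
  have h : HasDerivAt
      (fun u => ∑ i, ∑ j, Real.exp (-(s - u) * a i - u * b j) * (p i * O i j * q j))
      (∑ i, ∑ j, Real.exp (-(s - u) * a i - u * b j) * (a i - b j) * (p i * O i j * q j)) u := by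
    refine HasDerivAt.fun_sum fun i _ => HasDerivAt.fun_sum fun j _ => HasDerivAt.mul_const ?_ _
    refine HasDerivAt.exp ?_
    have h1 : HasDerivAt (fun u => -(s - u) * a i - u * b j) (1 * a i - 1 * b j) u := by
      refine HasDerivAt.sub (HasDerivAt.mul_const ?_ _) ((hasDerivAt_id' u).mul_const _)
      exact ((hasDerivAt_id' u).const_sub s).fun_neg.congr_deriv (neg_neg 1)
    simpa using h1
  convert h using 1
  rw [Finset.sum_mul_sum, ← Finset.sum_neg_distrib]
  refine Finset.sum_congr rfl fun i _ => ?_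
  rw [← Finset.sum_neg_distrib]
  refine Finset.sum_congr rfl fun j _ => ?_
  have hexp : Real.exp (-(s - u) * a i - u * b j) =
      Real.exp (-(s - u) * a i) * Real.exp (-u * b j) := by
    rw [← Real.exp_add]; ring_nf
  rw [hexp]
  linear_combination (-(Real.exp (-(s - u) * a i) * Real.exp (-u * b j) * p i * q j)) * hO i j

theorem rankOne_apply_zero (hp : ∀ i, p i = ∑ j, O i j * q j) (s : ℝ) :
    ∑ i, ∑ j, Real.exp (-(s - 0) * a i - 0 * b j) * (p i * O i j * q j) =
      ∑ i, Real.exp (-s * a i) * p i ^ 2 := by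
  refine Finset.sum_congr rfl fun i _ => ?_
  rw [sq]
  nth_rw 2 [hp i]
  rw [Finset.sum_mul, Finset.mul_sum]
  exact Finset.sum_congr rfl fun j _ => by simp only [sub_zero, zero_mul]; ring

theorem rankOne_apply_self (hq : ∀ j, q j = ∑ i, O i j * p i) (s : ℝ) :
    ∑ i, ∑ j, Real.exp (-(s - s) * a i - s * b j) * (p i * O i j * q j) =
      ∑ j, Real.exp (-s * b j) * q j ^ 2 := by
  rw [Finset.sum_comm]
  refine Finset.sum_congr rfl fun j _ => ?_
  rw [sq]
  nth_rw 2 [hq j]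
  rw [Finset.sum_mul, Finset.mul_sum]
  refine Finset.sum_congr rfl fun i _ => ?_
  simp only [sub_self, neg_zero, zero_mul, zero_sub, neg_mul]
  ring

/-- The interpolation is nonincreasing; compare u = 0 with u = s. -/
theorem sum_exp_rankOne_le (hO : ∀ i j, (a i - b j) * O i j = -(p i * q j))
    (hp : ∀ i, p i = ∑ j, O i j * q j) (hq : ∀ j, q j = ∑ i, O i j * p i) {s : ℝ} (hs : 0 ≤ s) :
    ∑ j, Real.exp (-s * b j) * q j ^ 2 ≤ ∑ i, Real.exp (-s * a i) * p i ^ 2 := by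
  rw [← rankOne_apply_zero (b := b) hp s, ← rankOne_apply_self (a := a) hq s]
  have hanti := antitone_of_hasDerivAt_nonpos (fun u => hasDerivAt_rankOne hO s u) fun u =>
    neg_nonpos.2 (by positivity)
  exact hanti hs

/-- The derivative of the interpolation is at least -F: bound the q-factor by its p-analogue, then
use log-convexity and ∑ pᵢ² ≤ 1. The mean value inequality on [0, s] gives a loss of at most sF. -/
theorem le_sum_exp_rankOne (hO : ∀ i j, (a i - b j) * O i j = -(p i * q j))
    (hp : ∀ i, p i = ∑ j, O i j * q j) (hq : ∀ j, q j = ∑ i, O i j * p i)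
    (hp1 : ∑ i, p i ^ 2 ≤ 1) {s : ℝ} (hs : 0 ≤ s) :
    (1 - s) * ∑ i, Real.exp (-s * a i) * p i ^ 2 ≤ ∑ j, Real.exp (-s * b j) * q j ^ 2 := by
  set F := ∑ i, Real.exp (-s * a i) * p i ^ 2 with hF
  have hF0 : 0 ≤ F := by positivity
  have hmvt := (convex_Icc (0 : ℝ) s).mul_sub_le_image_sub_of_le_deriv (C := -F)
    (fun u _ => (hasDerivAt_rankOne hO s u).continuousAt.continuousWithinAt)
    (fun u _ => (hasDerivAt_rankOne hO s u).differentiableAt.differentiableWithinAt)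
    (fun u hu => by
      rw [interior_Icc] at hu
      rw [(hasDerivAt_rankOne hO s u).deriv, neg_le_neg_iff]
      calc (∑ i, Real.exp (-(s - u) * a i) * p i ^ 2) * ∑ j, Real.exp (-u * b j) * q j ^ 2
          ≤ (∑ i, Real.exp (-(s - u) * a i) * p i ^ 2) *
              ∑ i, Real.exp (-u * a i) * p i ^ 2 := by
            gcongr ?_ * ?_
            exact sum_exp_rankOne_le hO hp hq hu.1.le
        _ ≤ (∑ i, p i ^ 2) * F :=
            sum_exp_mul_sum_exp_le a (fun i => p i ^ 2) (fun i => sq_nonneg _) hu.1.le hu.2.le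
        _ ≤ 1 * F := by gcongr
        _ = F := one_mul F)
    0 (Set.left_mem_Icc.2 hs) s (Set.right_mem_Icc.2 hs) hs
  rw [rankOne_apply_zero hp, rankOne_apply_self hq] at hmvt
  linarith

/-- A one-sided estimate of the trace of the exponential after a rank one update. -/
theorem sum_exp_rankOne_le_sub (hO : ∀ i j, (a i - b j) * O i j = -(p i * q j))
    (hp : ∀ i, p i = ∑ j, O i j * q j) (hq : ∀ j, q j = ∑ i, O i j * p i)
    (hrow : ∀ i, ∑ j, O i j ^ 2 = 1) (hcol : ∀ j, ∑ i, O i j ^ 2 = 1)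
    (hp1 : ∑ i, p i ^ 2 ≤ 1) {s : ℝ} (hs : 0 ≤ s) :
    ∑ j, Real.exp (-s * b j) ≤
      ∑ i, Real.exp (-s * a i) - s * (1 - s) * ∑ i, Real.exp (-s * a i) * p i ^ 2 := by
  -- Klein's inequality: the tangent line of exp(-s ·) at each bⱼ, weighted by the doubly stochastic
  -- matrix of the Oᵢⱼ².
  have hklein : 0 ≤ ∑ i, ∑ j, O i j ^ 2 *
      (Real.exp (-s * a i) - Real.exp (-s * b j) + s * Real.exp (-s * b j) * (a i - b j)) := by
    refine Finset.sum_nonneg fun i _ => Finset.sum_nonneg fun j _ =>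
      mul_nonneg (sq_nonneg _) ?_
    have h1 := Real.add_one_le_exp (-s * a i - -s * b j)
    have h2 : Real.exp (-s * a i) = Real.exp (-s * b j) * Real.exp (-s * a i - -s * b j) := by
      rw [← Real.exp_add]; ring_nf
    rw [h2]
    nlinarith [mul_le_mul_of_nonneg_left h1 (Real.exp_pos (-s * b j)).le]
  have hexpand : ∀ i j, O i j ^ 2 *
      (Real.exp (-s * a i) - Real.exp (-s * b j) + s * Real.exp (-s * b j) * (a i - b j)) =
      Real.exp (-s * a i) * O i j ^ 2 - Real.exp (-s * b j) * O i j ^ 2 -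
        s * (Real.exp (-s * b j) * q j * (O i j * p i)) := fun i j => by
    linear_combination (s * Real.exp (-s * b j) * O i j) * hO i j
  simp only [hexpand, Finset.sum_sub_distrib] at hklein
  have e1 : ∑ i, ∑ j, Real.exp (-s * a i) * O i j ^ 2 = ∑ i, Real.exp (-s * a i) :=
    Finset.sum_congr rfl fun i _ => by rw [← Finset.mul_sum, hrow, mul_one]
  have e2 : ∑ i, ∑ j, Real.exp (-s * b j) * O i j ^ 2 = ∑ j, Real.exp (-s * b j) := by
    rw [Finset.sum_comm]
    exact Finset.sum_congr rfl fun i _ => by rw [← Finset.mul_sum, hcol, mul_one]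
  have e3 : ∑ i, ∑ j, s * (Real.exp (-s * b j) * q j * (O i j * p i)) =
      s * ∑ j, Real.exp (-s * b j) * q j ^ 2 := by
    rw [Finset.sum_comm, Finset.mul_sum]
    refine Finset.sum_congr rfl fun j _ => ?_
    rw [← Finset.mul_sum, ← Finset.mul_sum, ← hq]
    ring
  rw [e1, e2, e3] at hklein
  nlinarith [mul_le_mul_of_nonneg_left (le_sum_exp_rankOne hO hp hq hp1 hs) hs]

end RankOneSpectra

/-! ### The trace of the matrix exponential. -/

section TraceExp

variable {ι : Type*} [Fintype ι] [DecidableEq ι]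

theorem exists_orthogonal_diagonalization {A : Matrix ι ι ℝ} (hA : A.IsHermitian) :
    ∃ (U : Matrix ι ι ℝ) (a : ι → ℝ), Uᵀ * U = 1 ∧ U * Uᵀ = 1 ∧ A = U * diagonal a * Uᵀ := by
  refine ⟨hA.eigenvectorUnitary, hA.eigenvalues, ?_, ?_, ?_⟩
  · exact Unitary.coe_star_mul_self hA.eigenvectorUnitary
  · exact Unitary.coe_mul_star_self hA.eigenvectorUnitary
  · have h := hA.spectral_theorem
    rw [Unitary.conjStarAlgAut_apply] at h
    exact h

theorem exp_smul_conj_diagonal {U : Matrix ι ι ℝ} (hU : Uᵀ * U = 1) (a : ι → ℝ) (t : ℝ) :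
    NormedSpace.exp (t • (U * diagonal a * Uᵀ)) =
      U * diagonal (fun i => Real.exp (t * a i)) * Uᵀ := by
  have hinv : U⁻¹ = Uᵀ := Matrix.inv_eq_left_inv hU
  have hunit : IsUnit U := by
    rw [Matrix.isUnit_iff_isUnit_det]
    exact Matrix.isUnit_det_of_left_inverse hU
  have h : t • (U * diagonal a * Uᵀ) = U * diagonal (t • a) * U⁻¹ := by
    rw [hinv, Matrix.diagonal_smul, Matrix.mul_smul, Matrix.smul_mul]
  rw [h, Matrix.exp_conj U _ hunit, Matrix.exp_diagonal, hinv]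
  congr 3
  ext i
  rw [Pi.coe_exp, ← Real.exp_eq_exp_ℝ]
  simp

theorem trace_conj_diagonal {U : Matrix ι ι ℝ} (hU : Uᵀ * U = 1) (a : ι → ℝ) :
    (U * diagonal a * Uᵀ).trace = ∑ i, a i := by
  rw [Matrix.trace_mul_comm, ← Matrix.mul_assoc, hU, Matrix.one_mul, Matrix.trace_diagonal]

theorem dotProduct_conj_diagonal_mulVec (U : Matrix ι ι ℝ) (a : ι → ℝ) (x : ι → ℝ) :
    x ⬝ᵥ ((U * diagonal a * Uᵀ) *ᵥ x) = ∑ i, a i * (Uᵀ *ᵥ x) i ^ 2 := by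
  rw [← Matrix.mulVec_mulVec, ← Matrix.mulVec_mulVec, Matrix.dotProduct_mulVec,
    ← Matrix.mulVec_transpose]
  simp only [dotProduct, Matrix.mulVec_diagonal]
  exact Finset.sum_congr rfl fun i _ => by ring

theorem sum_transpose_mulVec_sq {U : Matrix ι ι ℝ} (hU : U * Uᵀ = 1) (x : ι → ℝ) :
    ∑ i, (Uᵀ *ᵥ x) i ^ 2 = x ⬝ᵥ x := by
  have h := dotProduct_conj_diagonal_mulVec U (fun _ => 1) x
  rw [Matrix.diagonal_one, Matrix.mul_one, hU, Matrix.one_mulVec] at h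
  simpa using h.symm

theorem isHermitian_vecMulVec_self {κ : Type*} (x : κ → ℝ) : (vecMulVec x x).IsHermitian := by
  ext i j
  simp [vecMulVec_apply, mul_comm]

/-- The trace of `exp (-s A)` drops by at least `s (1 - s) xᵀ exp (-s A) x` when the rank one
matrix `x xᵀ`, with `‖x‖ ≤ 1`, is added to `A`. -/
theorem trace_exp_add_vecMulVec_le {A : Matrix ι ι ℝ} (hA : A.IsHermitian) {x : ι → ℝ}
    (hx : x ⬝ᵥ x ≤ 1) {s : ℝ} (hs : 0 ≤ s) :
    (NormedSpace.exp (-s • (A + vecMulVec x x))).trace ≤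
      (NormedSpace.exp (-s • A)).trace -
        s * (1 - s) * (x ⬝ᵥ (NormedSpace.exp (-s • A) *ᵥ x)) := by
  obtain ⟨V, b, hV, hV', hB⟩ := exists_orthogonal_diagonalization
    (hA.add (isHermitian_vecMulVec_self x))
  obtain ⟨U, a, hU, hU', rfl⟩ := exists_orthogonal_diagonalization hA
  rw [hB, exp_smul_conj_diagonal hV, exp_smul_conj_diagonal hU, trace_conj_diagonal hV,
    trace_conj_diagonal hU, dotProduct_conj_diagonal_mulVec]
  -- This is Uᵀ(A - B)V = -(Uᵀx)(Vᵀx)ᵀ, the mixed-coordinate identity behind the rank one estimates,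
  -- with O = UᵀV.
  have hdiff : diagonal a * (Uᵀ * V) - (Uᵀ * V) * diagonal b =
      -vecMulVec (Uᵀ *ᵥ x) (Vᵀ *ᵥ x) := by
    have h1 : Uᵀ * (U * diagonal a * Uᵀ) * V = diagonal a * (Uᵀ * V) := by
      simp only [← Matrix.mul_assoc]
      rw [hU, Matrix.one_mul]
    have h2 : Uᵀ * (V * diagonal b * Vᵀ) * V = (Uᵀ * V) * diagonal b := by
      simp only [Matrix.mul_assoc]
      rw [hV, Matrix.mul_one]
    have h3 : Uᵀ * vecMulVec x x * V = vecMulVec (Uᵀ *ᵥ x) (Vᵀ *ᵥ x) := by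
      rw [Matrix.mul_vecMulVec, Matrix.vecMulVec_mul, Matrix.mulVec_transpose V]
    rw [← h1, ← h2, ← hB, ← h3, Matrix.mul_add, Matrix.add_mul]
    abel
  refine sum_exp_rankOne_le_sub (O := fun i j => (Uᵀ * V) i j) (p := Uᵀ *ᵥ x) (q := Vᵀ *ᵥ x)
    ?_ ?_ ?_ ?_ ?_ ?_ hs
  · intro i j
    have h := congrFun (congrFun hdiff i) j
    simp only [Matrix.sub_apply, Matrix.diagonal_mul, Matrix.mul_diagonal, Matrix.neg_apply,
      vecMulVec_apply] at h
    linarith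
  · intro i
    have h : Uᵀ *ᵥ x = (Uᵀ * V) *ᵥ (Vᵀ *ᵥ x) := by
      rw [Matrix.mulVec_mulVec, Matrix.mul_assoc, hV', Matrix.mul_one]
    conv_lhs => rw [h]
    rfl
  · intro j
    have h : Vᵀ *ᵥ x = (Uᵀ * V)ᵀ *ᵥ (Uᵀ *ᵥ x) := by
      rw [Matrix.mulVec_mulVec, Matrix.transpose_mul, Matrix.transpose_transpose,
        Matrix.mul_assoc, hU', Matrix.mul_one]
    conv_lhs => rw [h]
    rfl
  · intro i
    have h : (Uᵀ * V) * (Uᵀ * V)ᵀ = 1 := by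
      rw [Matrix.transpose_mul, Matrix.transpose_transpose, Matrix.mul_assoc,
        ← Matrix.mul_assoc V, hV', Matrix.one_mul, hU]
    have h' := congrFun (congrFun h i) i
    rw [Matrix.mul_apply, Matrix.one_apply_eq] at h'
    simpa [sq] using h'
  · intro j
    have h : (Uᵀ * V)ᵀ * (Uᵀ * V) = 1 := by
      rw [Matrix.transpose_mul, Matrix.transpose_transpose, Matrix.mul_assoc,
        ← Matrix.mul_assoc U, hU', Matrix.one_mul, hV]
    have h' := congrFun (congrFun h j) j
    rw [Matrix.mul_apply, Matrix.one_apply_eq] at h'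
    simpa [sq] using h'
  · rw [sum_transpose_mulVec_sq hU']
    exact hx

/-- If `tr exp (-s A) < exp (-s c)` then all eigenvalues of `A` exceed `c`. -/
theorem lt_dotProduct_mulVec_of_trace_exp_lt {A : Matrix ι ι ℝ} (hA : A.IsHermitian) {s c : ℝ}
    (hs : 0 < s) (h : (NormedSpace.exp (-s • A)).trace < Real.exp (-s * c)) {v : ι → ℝ}
    (hv : v ≠ 0) : c * (v ⬝ᵥ v) < v ⬝ᵥ (A *ᵥ v) := by
  obtain ⟨U, a, hU, hU', rfl⟩ := exists_orthogonal_diagonalization hA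
  rw [exp_smul_conj_diagonal hU, trace_conj_diagonal hU] at h
  have ha : ∀ i, c < a i := by
    intro i
    have h1 : Real.exp (-s * a i) < Real.exp (-s * c) :=
      (Finset.single_le_sum (f := fun i => Real.exp (-s * a i))
        (fun j _ => (Real.exp_pos _).le) (Finset.mem_univ i)).trans_lt h
    rw [Real.exp_lt_exp] at h1
    nlinarith
  rw [dotProduct_conj_diagonal_mulVec, ← sum_transpose_mulVec_sq hU' v, Finset.mul_sum]
  have hne : ∃ i, (Uᵀ *ᵥ v) i ≠ 0 := by
    by_contra! hzero
    apply hv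
    have h0 : Uᵀ *ᵥ v = 0 := funext hzero
    rw [← Matrix.one_mulVec v, ← hU', ← Matrix.mulVec_mulVec, h0, Matrix.mulVec_zero]
  obtain ⟨i, hi⟩ := hne
  refine Finset.sum_lt_sum (fun j _ => by gcongr; exact (ha j).le) ⟨i, Finset.mem_univ i, ?_⟩
  have : 0 < (Uᵀ *ᵥ v) i ^ 2 := by positivity
  gcongr
  exact ha i

theorem exp_smul_posSemidef {A : Matrix ι ι ℝ} (hA : A.IsHermitian) (t : ℝ) :
    (NormedSpace.exp (t • A)).PosSemidef := by
  obtain ⟨U, a, hU, hU', rfl⟩ := exists_orthogonal_diagonalization hA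
  rw [exp_smul_conj_diagonal hU]
  have h : (diagonal fun i => Real.exp (t * a i)).PosSemidef :=
    Matrix.posSemidef_diagonal_iff.2 fun i => (Real.exp_pos _).le
  simpa using h.mul_mul_conjTranspose_same U

theorem continuous_exp_smul (t : ℝ) :
    Continuous fun A : Matrix ι ι ℝ => NormedSpace.exp (t • A) := by
  let _ : NormedRing (Matrix ι ι ℝ) := Matrix.linftyOpNormedRing
  let _ : NormedAlgebra ℝ (Matrix ι ι ℝ) := Matrix.linftyOpNormedAlgebra
  let _ : NormedAlgebra ℚ (Matrix ι ι ℝ) := NormedAlgebra.restrictScalars ℚ ℝ _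
  have : CompleteSpace (Matrix ι ι ℝ) := FiniteDimensional.complete ℝ _
  exact NormedSpace.exp_continuous.comp (continuous_const_smul t)

/-- For positive semidefinite `S` and `P` with `S ≥ c`, `tr (S P) ≥ c tr P`. -/
theorem mul_trace_le_sum_mul {S P : Matrix ι ι ℝ} {c : ℝ}
    (hS : ∀ v : ι → ℝ, c * (v ⬝ᵥ v) ≤ v ⬝ᵥ (S *ᵥ v)) (hP : P.PosSemidef) :
    c * P.trace ≤ (S * P).trace := by
  obtain ⟨U, a, hU, hU', rfl⟩ := exists_orthogonal_diagonalization hP.1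
  have ha : ∀ i, 0 ≤ a i := by
    intro i
    have h := hP.dotProduct_mulVec_nonneg (U *ᵥ Pi.single i 1)
    rw [star_trivial, dotProduct_conj_diagonal_mulVec, Matrix.mulVec_mulVec, hU,
      Matrix.one_mulVec] at h
    simpa [Pi.single_apply] using h
  rw [trace_conj_diagonal hU, ← Matrix.mul_assoc, Matrix.trace_mul_comm, ← Matrix.mul_assoc,
    ← Matrix.mul_assoc, Matrix.trace, Finset.mul_sum]
  refine Finset.sum_le_sum fun i _ => ?_
  rw [Matrix.diag_apply, Matrix.mul_diagonal]
  gcongr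
  · exact ha i
  -- The test vector is the i-th eigenvector of P.
  have h := hS (U *ᵥ Pi.single i 1)
  have h1 : (U *ᵥ Pi.single i 1) ⬝ᵥ (U *ᵥ Pi.single i 1) = 1 := by
    rw [Matrix.dotProduct_mulVec, ← Matrix.mulVec_transpose, Matrix.mulVec_mulVec, hU,
      Matrix.one_mulVec]
    simp
  have h2 : (U *ᵥ Pi.single i 1) ⬝ᵥ (S *ᵥ (U *ᵥ Pi.single i 1)) = (Uᵀ * S * U) i i := by
    rw [dotProduct_comm, Matrix.dotProduct_mulVec, ← Matrix.mulVec_transpose,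
      Matrix.mulVec_mulVec, Matrix.mulVec_mulVec]
    simp
  rw [h1, h2, mul_one] at h
  exact h

end TraceExp

/-! ### Lower tail of the spectrum of a sum of independent rank one matrices. -/

section MatrixConcentration

variable {ι : Type*} {d : ℕ}

/-- The Gram matrix `∑ zᵢ zᵢᵀ` of the vectors indexed by `S`. -/
def partialGram (S : Finset ι) (z : ι → Fin d → ℝ) : Matrix (Fin d) (Fin d) ℝ :=
  ∑ i ∈ S, vecMulVec (z i) (z i)

theorem isHermitian_partialGram (S : Finset ι) (z : ι → Fin d → ℝ) :
    (partialGram S z).IsHermitian := by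
  ext a b
  simp [partialGram, Matrix.sum_apply, vecMulVec_apply, mul_comm]

theorem continuous_exp_partialGram (S : Finset ι) (s : ℝ) :
    Continuous fun z : ι → Fin d → ℝ => NormedSpace.exp (-s • partialGram S z) := by
  refine (continuous_exp_smul (-s)).comp ?_
  refine continuous_finsetSum _ fun i _ => ?_
  exact (continuous_apply i).matrix_vecMulVec (continuous_apply i)

theorem continuous_exp_partialGram_apply (S : Finset ι) (s : ℝ) (a b : Fin d) :
    Continuous fun z : ι → Fin d → ℝ => NormedSpace.exp (-s • partialGram S z) a b :=
  (continuous_exp_partialGram S s).matrix_elem a b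

theorem abs_apply_le_one {x : Fin d → ℝ} (hx : x ⬝ᵥ x ≤ 1) (a : Fin d) : |x a| ≤ 1 := by
  rw [← sq_le_one_iff_abs_le_one, sq]
  exact (Finset.single_le_sum (f := fun a => x a * x a) (fun b _ => mul_self_nonneg _)
    (Finset.mem_univ a)).trans hx

theorem posSemidef_integral {Ω : Type*} [MeasurableSpace Ω] {μ : Measure Ω}
    {M : Ω → Matrix (Fin d) (Fin d) ℝ} (hM : ∀ ω, (M ω).PosSemidef)
    (hint : ∀ a b, Integrable (fun ω => M ω a b) μ) :
    (Matrix.of fun a b => ∫ ω, M ω a b ∂μ).PosSemidef := by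
  refine Matrix.PosSemidef.of_dotProduct_mulVec_nonneg ?_ fun v => ?_
  · ext a b
    simp only [Matrix.conjTranspose_apply, Matrix.of_apply, star_trivial]
    refine integral_congr_ae (Filter.Eventually.of_forall fun ω => ?_)
    simpa using (hM ω).1.apply a b
  · have h : star v ⬝ᵥ ((Matrix.of fun a b => ∫ ω, M ω a b ∂μ) *ᵥ v) =
        ∫ ω, v ⬝ᵥ (M ω *ᵥ v) ∂μ := by
      simp only [star_trivial, dotProduct, Matrix.mulVec, Matrix.of_apply]
      rw [integral_finsetSum _ fun a _ => (integrable_finsetSum _ fun b _ =>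
        (hint a b).mul_const _).const_mul _]
      refine Finset.sum_congr rfl fun a _ => ?_
      rw [integral_const_mul, integral_finsetSum _ fun b _ => (hint a b).mul_const _]
      simp only [integral_mul_const]
    rw [h]
    exact integral_nonneg fun ω => by
      simpa using (hM ω).dotProduct_mulVec_nonneg v

variable {Ω : Type*} [MeasurableSpace Ω] {μ : Measure Ω} {x : ι → Ω → Fin d → ℝ}

/-- As t ∉ S, the two sides depend on disjoint blocks of the independent family; the Gram matrix is
rewritten over the subtype of S to exhibit it as a function of its block. -/
theorem indepFun_exp_partialGram [DecidableEq ι] (hind : iIndepFun x μ)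
    (hmeas : ∀ i, Measurable (x i)) {S : Finset ι} {t : ι} (ht : t ∉ S) (s : ℝ)
    (a b a' b' : Fin d) :
    IndepFun (fun ω => x t ω a' * x t ω b')
      (fun ω => NormedSpace.exp (-s • partialGram S fun i => x i ω) a b) μ := by
  have h := hind.indepFun_finset {t} S (Finset.disjoint_singleton_left.2 ht) hmeas
  have hf : Measurable fun z : ({t} : Finset ι) → Fin d → ℝ =>
      z ⟨t, Finset.mem_singleton_self t⟩ a' * z ⟨t, Finset.mem_singleton_self t⟩ b' := by
    fun_prop
  have hg := (continuous_exp_partialGram_apply (ι := S) Finset.univ s a b).measurable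
  have h' := h.comp hf hg
  refine h'.congr (Filter.EventuallyEq.refl _ _) (Filter.Eventually.of_forall fun ω => ?_)
  have : partialGram (Finset.univ : Finset S) (fun i => x i ω) = partialGram S fun i => x i ω :=
    Finset.sum_coe_sort S fun i => vecMulVec (x i ω) (x i ω)
  simp only [Function.comp_apply, this]

variable [IsProbabilityMeasure μ]

theorem integrable_mul_apply {X : Ω → Fin d → ℝ} (hmeas : Measurable X)
    (hX : ∀ ω, X ω ⬝ᵥ X ω ≤ 1) (a b : Fin d) : Integrable (fun ω => X ω a * X ω b) μ := by
  have hm : ∀ a, Measurable fun ω => X ω a := fun a => (measurable_pi_apply a).comp hmeas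
  refine Integrable.of_bound ((hm a).mul (hm b)).aestronglyMeasurable 1
    (Filter.Eventually.of_forall fun ω => ?_)
  rw [Real.norm_eq_abs, abs_mul]
  exact mul_le_one₀ (abs_apply_le_one (hX ω) a) (abs_nonneg _) (abs_apply_le_one (hX ω) b)

variable [Fintype ι]

/-- The vectors stay in a compact ball of the sup norm, on which the continuous integrand is
bounded. -/
theorem integrable_exp_partialGram (hmeas : ∀ i, Measurable (x i))
    (hx : ∀ i ω, x i ω ⬝ᵥ x i ω ≤ 1) (S : Finset ι) (s : ℝ) (a b : Fin d) :
    Integrable (fun ω => NormedSpace.exp (-s • partialGram S fun i => x i ω) a b) μ := by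
  have hc := continuous_exp_partialGram_apply (ι := ι) S s a b
  obtain ⟨R, hR⟩ := (isCompact_closedBall (0 : ι → Fin d → ℝ) 1).exists_bound_of_continuousOn
    hc.continuousOn
  refine Integrable.of_bound
    (hc.measurable.comp (measurable_pi_lambda _ hmeas)).aestronglyMeasurable R
    (Filter.Eventually.of_forall fun ω => hR _ ?_)
  rw [mem_closedBall_zero_iff, pi_norm_le_iff_of_nonneg zero_le_one]
  intro i
  rw [pi_norm_le_iff_of_nonneg zero_le_one]
  exact fun a => abs_apply_le_one (hx i ω) a

theorem integrable_trace_exp_partialGram (hmeas : ∀ i, Measurable (x i))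
    (hx : ∀ i ω, x i ω ⬝ᵥ x i ω ≤ 1) (S : Finset ι) (s : ℝ) :
    Integrable (fun ω => (NormedSpace.exp (-s • partialGram S fun i => x i ω)).trace) μ :=
  integrable_finsetSum _ fun a _ => integrable_exp_partialGram hmeas hx S s a a

theorem integrable_dotProduct_exp_mulVec [DecidableEq ι] (hind : iIndepFun x μ)
    (hmeas : ∀ i, Measurable (x i))
    (hx : ∀ i ω, x i ω ⬝ᵥ x i ω ≤ 1) {S : Finset ι} {t : ι} (ht : t ∉ S) (s : ℝ) (a b : Fin d) :
    Integrable (fun ω => x t ω a * x t ω b *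
      NormedSpace.exp (-s • partialGram S fun i => x i ω) b a) μ :=
  (indepFun_exp_partialGram hind hmeas ht s b a a b).integrable_mul
    (integrable_mul_apply (hmeas t) (hx t) a b) (integrable_exp_partialGram hmeas hx S s b a)

theorem dotProduct_mulVec_eq_sum (v : Fin d → ℝ) (M : Matrix (Fin d) (Fin d) ℝ) :
    v ⬝ᵥ (M *ᵥ v) = ∑ a, ∑ b, v a * v b * M b a := by
  rw [Finset.sum_comm]
  simp only [dotProduct, Matrix.mulVec, Finset.mul_sum]
  exact Finset.sum_congr rfl fun a _ => Finset.sum_congr rfl fun b _ => by ring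

/-- By independence E[xᵀPx] = tr(E[xxᵀ] E[P]), where E[P] is positive semidefinite and E[xxᵀ] ≥ c.
-/
theorem le_integral_dotProduct_exp_mulVec [DecidableEq ι] (hind : iIndepFun x μ)
    (hmeas : ∀ i, Measurable (x i)) (hx : ∀ i ω, x i ω ⬝ᵥ x i ω ≤ 1) {c : ℝ}
    (hreg : ∀ i (v : Fin d → ℝ), c * (v ⬝ᵥ v) ≤ ∫ ω, (x i ω ⬝ᵥ v) ^ 2 ∂μ)
    {S : Finset ι} {t : ι} (ht : t ∉ S) (s : ℝ) :
    c * ∫ ω, (NormedSpace.exp (-s • partialGram S fun i => x i ω)).trace ∂μ ≤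
      ∫ ω, x t ω ⬝ᵥ (NormedSpace.exp (-s • partialGram S fun i => x i ω) *ᵥ x t ω) ∂μ := by
  set M : Ω → Matrix (Fin d) (Fin d) ℝ := fun ω =>
    NormedSpace.exp (-s • partialGram S fun i => x i ω) with hM
  have hMint : ∀ a b, Integrable (fun ω => M ω a b) μ :=
    integrable_exp_partialGram hmeas hx S s
  have hP : (Matrix.of fun a b => ∫ ω, M ω a b ∂μ).PosSemidef :=
    posSemidef_integral (fun ω => exp_smul_posSemidef (isHermitian_partialGram _ _) _) hMint
  have hS : ∀ v : Fin d → ℝ, c * (v ⬝ᵥ v) ≤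
      v ⬝ᵥ ((Matrix.of fun a b => ∫ ω, x t ω a * x t ω b ∂μ) *ᵥ v) := by
    intro v
    refine (hreg t v).trans (le_of_eq ?_)
    rw [dotProduct_mulVec_eq_sum]
    have : ∀ ω, (x t ω ⬝ᵥ v) ^ 2 = ∑ a, ∑ b, v a * v b * (x t ω b * x t ω a) := fun ω => by
      rw [sq, dotProduct, Finset.sum_mul_sum]
      exact Finset.sum_congr rfl fun a _ => Finset.sum_congr rfl fun b _ => by ring
    simp only [this, Matrix.of_apply]
    rw [integral_finsetSum _ fun a _ => integrable_finsetSum _ fun b _ =>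
      (integrable_mul_apply (hmeas t) (hx t) b a).const_mul _]
    refine Finset.sum_congr rfl fun a _ => ?_
    rw [integral_finsetSum _ fun b _ => (integrable_mul_apply (hmeas t) (hx t) b a).const_mul _]
    simp only [integral_const_mul]
  have h := mul_trace_le_sum_mul hS hP
  have htrace : (Matrix.of fun a b => ∫ ω, M ω a b ∂μ).trace = ∫ ω, (M ω).trace ∂μ := by
    simp only [Matrix.trace, Matrix.diag_apply, Matrix.of_apply]
    rw [integral_finsetSum _ fun a _ => hMint a a]
  rw [htrace] at h
  refine h.trans (le_of_eq ?_)
  simp only [dotProduct_mulVec_eq_sum]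
  rw [integral_finsetSum _ fun a _ => integrable_finsetSum _ fun b _ =>
    integrable_dotProduct_exp_mulVec hind hmeas hx ht s a b]
  refine Finset.sum_congr rfl fun a _ => ?_
  rw [integral_finsetSum _ fun b _ => integrable_dotProduct_exp_mulVec hind hmeas hx ht s a b,
    Matrix.diag_apply, Matrix.mul_apply]
  refine Finset.sum_congr rfl fun b _ => ?_
  exact ((indepFun_exp_partialGram hind hmeas ht s b a a b).integral_fun_mul_eq_mul_integral
    (integrable_mul_apply (hmeas t) (hx t) a b).aestronglyMeasurable
    (hMint b a).aestronglyMeasurable).symm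

/-- Exponential decay of the expected trace exponential of a sum of independent rank one
matrices. -/
theorem integral_trace_exp_partialGram_le (hind : iIndepFun x μ)
    (hmeas : ∀ i, Measurable (x i)) (hx : ∀ i ω, x i ω ⬝ᵥ x i ω ≤ 1) {c : ℝ}
    (hreg : ∀ i (v : Fin d → ℝ), c * (v ⬝ᵥ v) ≤ ∫ ω, (x i ω ⬝ᵥ v) ^ 2 ∂μ)
    {s : ℝ} (hs₀ : 0 ≤ s) (hs₁ : s ≤ 1) (S : Finset ι) :
    ∫ ω, (NormedSpace.exp (-s • partialGram S fun i => x i ω)).trace ∂μ ≤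
      d * Real.exp (-(s * (1 - s) * c) * S.card) := by
  classical
  induction S using Finset.induction_on with
  | empty => simp [partialGram, NormedSpace.exp_zero]
  | insert t S ht ih =>
    set E := ∫ ω, (NormedSpace.exp (-s • partialGram S fun i => x i ω)).trace ∂μ with hE
    have hE0 : 0 ≤ E := integral_nonneg fun ω =>
      (exp_smul_posSemidef (isHermitian_partialGram _ _) _).trace_nonneg
    have hκ : 0 ≤ s * (1 - s) := mul_nonneg hs₀ (by linarith)
    have hquad : Integrable (fun ω => x t ω ⬝ᵥ
        (NormedSpace.exp (-s • partialGram S fun i => x i ω) *ᵥ x t ω)) μ := by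
      simp only [dotProduct_mulVec_eq_sum]
      exact integrable_finsetSum _ fun a _ => integrable_finsetSum _ fun b _ =>
        integrable_dotProduct_exp_mulVec hind hmeas hx ht s a b
    have hstep : ∫ ω, (NormedSpace.exp (-s • partialGram (insert t S) fun i => x i ω)).trace ∂μ ≤
        E - s * (1 - s) * ∫ ω, x t ω ⬝ᵥ
          (NormedSpace.exp (-s • partialGram S fun i => x i ω) *ᵥ x t ω) ∂μ := by
      rw [hE, ← integral_const_mul, ← integral_sub
        (integrable_trace_exp_partialGram hmeas hx S s) (hquad.const_mul _)]
      refine integral_mono (integrable_trace_exp_partialGram hmeas hx _ s)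
        ((integrable_trace_exp_partialGram hmeas hx S s).sub (hquad.const_mul _)) fun ω => ?_
      have hins : partialGram (insert t S) (fun i => x i ω) =
          partialGram S (fun i => x i ω) + vecMulVec (x t ω) (x t ω) := by
        rw [partialGram, Finset.sum_insert ht, add_comm, partialGram]
      simp only [hins]
      exact trace_exp_add_vecMulVec_le (isHermitian_partialGram _ _) (hx t ω) hs₀
    have hlow := mul_le_mul_of_nonneg_left
      (le_integral_dotProduct_exp_mulVec hind hmeas hx hreg ht s) hκ
    calc ∫ ω, (NormedSpace.exp (-s • partialGram (insert t S) fun i => x i ω)).trace ∂μ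
        ≤ (-(s * (1 - s) * c) + 1) * E := by linarith
      _ ≤ Real.exp (-(s * (1 - s) * c)) * E := by
          gcongr
          exact Real.add_one_le_exp _
      _ ≤ Real.exp (-(s * (1 - s) * c)) * (d * Real.exp (-(s * (1 - s) * c) * S.card)) := by
          gcongr
      _ = d * Real.exp (-(s * (1 - s) * c) * (insert t S).card) := by
          rw [Finset.card_insert_of_notMem ht, mul_left_comm, ← Real.exp_add]
          push_cast
          ring_nf

/-- The trace exponential of the Gram matrix is small with high probability. -/
theorem measureReal_trace_exp_partialGram_ge_le (hind : iIndepFun x μ)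
    (hmeas : ∀ i, Measurable (x i)) (hx : ∀ i ω, x i ω ⬝ᵥ x i ω ≤ 1) {c : ℝ}
    (hreg : ∀ i (v : Fin d → ℝ), c * (v ⬝ᵥ v) ≤ ∫ ω, (x i ω ⬝ᵥ v) ^ 2 ∂μ) :
    μ.real {ω | Real.exp (-(1 / 2) * (c * Fintype.card ι / 8)) ≤
      (NormedSpace.exp (-(1 / 2 : ℝ) • partialGram Finset.univ fun i => x i ω)).trace} ≤
      d * Real.exp (-(3 * c * Fintype.card ι / 16)) := by
  -- The value s = 1/2 maximizes s(1-s) and gives decay exp(-cn/4), with n the number of vectors.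
  -- Markov at level exp(-cn/16) leaves the exponent -3cn/16.
  have h1 := integral_trace_exp_partialGram_le hind hmeas hx hreg (s := 1 / 2) (by norm_num)
    (by norm_num) Finset.univ
  have h2 := mul_meas_ge_le_integral_of_nonneg (μ := μ)
    (f := fun ω => (NormedSpace.exp (-(1 / 2 : ℝ) • partialGram Finset.univ
      fun i => x i ω)).trace)
    (Filter.Eventually.of_forall fun ω =>
      (exp_smul_posSemidef (isHermitian_partialGram _ _) _).trace_nonneg)
    (integrable_trace_exp_partialGram hmeas hx _ _)
    (Real.exp (-(1 / 2) * (c * Fintype.card ι / 8)))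
  have h3 := h2.trans h1
  rw [mul_comm, ← le_div_iff₀ (Real.exp_pos _), mul_div_assoc (d : ℝ), ← Real.exp_sub] at h3
  refine h3.trans (le_of_eq ?_)
  rw [Finset.card_univ]
  ring_nf

end MatrixConcentration

/-! ### Cliques of a disjoint union of complete graphs. -/

/-- Each part is a clique, and a clique containing i lies in the part of i. Without vertices the
empty clique would be maximal, though no partition has an empty part; hence `Nonempty V`. -/
theorem maximalCliques_eq_parts {V : Type*} [Fintype V] [DecidableEq V] [Nonempty V]
    {G : SimpleGraph V} {C : Finpartition (Finset.univ : Finset V)}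
    (h : ∀ i j, i ≠ j → (G.Adj i j ↔ C.part i = C.part j)) :
    maximalCliques G = (C.parts : Set (Finset V)) := by
  have hclique : ∀ i, G.IsClique (C.part i : Set V) := by
    intro i a ha b hb hab
    rw [h a b hab]
    have ha' := (C.mem_part_iff_part_eq_part (Finset.mem_univ a) (Finset.mem_univ i)).1 ha
    have hb' := (C.mem_part_iff_part_eq_part (Finset.mem_univ b) (Finset.mem_univ i)).1 hb
    rw [ha', hb']
  have hsub : ∀ {t : Finset V} {i : V}, G.IsClique (t : Set V) → i ∈ t → t ⊆ C.part i := by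
    intro t i ht hi j hj
    rw [C.mem_part_iff_part_eq_part (Finset.mem_univ j) (Finset.mem_univ i)]
    by_cases hji : j = i
    · rw [hji]
    · exact (h j i hji).1 (ht hj hi hji)
  ext s
  constructor
  · intro hs
    have hne : s.Nonempty := by
      rw [Finset.nonempty_iff_ne_empty]
      rintro rfl
      obtain ⟨i⟩ := ‹Nonempty V›
      have := hs.2 (y := {i}) (by simp) (Finset.empty_subset _)
      exact absurd (this (Finset.mem_singleton_self i)) (Finset.notMem_empty i)
    obtain ⟨i, hi⟩ := hne
    have hle := hsub hs.1 hi
    have heq : s = C.part i := le_antisymm hle (hs.2 (hclique i) hle)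
    rw [heq]
    exact C.part_mem.2 (Finset.mem_univ i)
  · intro hs
    obtain ⟨i, hi⟩ := C.nonempty_of_mem_parts hs
    have heq := C.part_eq_of_mem hs hi
    refine ⟨heq ▸ hclique i, fun t ht hst => ?_⟩
    rw [← heq]
    exact hsub ht (hst hi)

/-! ### Conditioning on the designs and the two kinds of test error. -/

/-- Independence makes the joint law a product, so Fubini turns an almost sure bound on slices into
a bound on the event. -/
theorem measure_prodMk_mem_le {Ω α β : Type*} [MeasurableSpace Ω] [MeasurableSpace α]
    [MeasurableSpace β] {μ : Measure Ω} [IsProbabilityMeasure μ] {D : Ω → α} {η : Ω → β}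
    (hD : Measurable D) (hη : Measurable η) (hind : IndepFun D η μ) {B : Set (α × β)}
    (hB : MeasurableSet B) {p : ENNReal}
    (h : ∀ᵐ ω ∂μ, μ.map η (Prod.mk (D ω) ⁻¹' B) ≤ p) :
    μ {ω | (D ω, η ω) ∈ B} ≤ p := by
  have : IsProbabilityMeasure (μ.map η) := Measure.isProbabilityMeasure_map hη.aemeasurable
  calc μ {ω | (D ω, η ω) ∈ B} = μ.map (fun ω => (D ω, η ω)) B :=
        (Measure.map_apply (hD.prodMk hη) hB).symm
    _ = ∫⁻ x, μ.map η (Prod.mk x ⁻¹' B) ∂(μ.map D) := by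
        rw [hind.map_prod_eq_prod_map_map hD.aemeasurable hη.aemeasurable, Measure.prod_apply hB]
    _ = ∫⁻ ω, μ.map η (Prod.mk (D ω) ⁻¹' B) ∂μ :=
        lintegral_map (measurable_measure_prodMk_left hB) hD
    _ ≤ ∫⁻ _, p ∂μ := lintegral_mono_ae h
    _ = p := by simp

theorem noncentralChiSq_Ioi_le {p : ℝ} (hp₀ : 0 < p) (k : ℕ)
    {ψ ψ₀ x : ℝ} (hψ : ψ ≤ ψ₀) (hx : chiSqQuantile (1 - p) k ψ₀ ≤ x) :
    noncentralChiSq k ψ (Set.Ioi x) ≤ ENNReal.ofReal p := by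
  have h1 : 1 - p ≤ chiSqCDF x k ψ :=
    (le_chiSqCDF_of_chiSqQuantile_le (by linarith) hx).trans (chiSqCDF_antitone x k hψ)
  rw [← Set.compl_Iic, prob_compl_eq_one_sub measurableSet_Iic, ← ofReal_chiSqCDF,
    ← ENNReal.ofReal_one, ← ENNReal.ofReal_sub _ (by rw [chiSqCDF_eq]; exact measureReal_nonneg)]
  exact ENNReal.ofReal_le_ofReal (by linarith)

variable {n d : ℕ}

theorem dotProduct_partialGram_mulVec (z : Fin n → Fin d → ℝ) (v : Fin d → ℝ) :
    v ⬝ᵥ (partialGram Finset.univ z *ᵥ v) = (Matrix.of z *ᵥ v) ⬝ᵥ (Matrix.of z *ᵥ v) := by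
  have h : partialGram Finset.univ z = (Matrix.of z)ᵀ * Matrix.of z := by
    ext a b
    simp [partialGram, Matrix.sum_apply, vecMulVec_apply, Matrix.mul_apply]
  rw [h, ← Matrix.mulVec_mulVec, Matrix.dotProduct_mulVec, Matrix.vecMul_transpose]

/-- All three ranks equal d: stacking rows preserves injectivity, and d + d - d = d. -/
theorem testDF_eq_of_injective {X₁ X₂ : Matrix (Fin n) (Fin d) ℝ}
    (h₁ : ∀ v, X₁ *ᵥ v = 0 → v = 0) (h₂ : ∀ v, X₂ *ᵥ v = 0 → v = 0) : testDF X₁ X₂ = d := by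
  have key : ∀ {m : Type} [Fintype m] (X : Matrix m (Fin d) ℝ), (∀ v, X *ᵥ v = 0 → v = 0) →
      X.rank = d := by
    intro m _ X hX
    rw [Matrix.rank, LinearMap.finrank_range_of_inj, Module.finrank_fin_fun]
    rw [← LinearMap.ker_eq_bot]
    exact LinearMap.ker_eq_bot'.2 hX
  rw [testDF, key X₁ h₁, key X₂ h₂, key (fromRows X₁ X₂)]
  · omega
  · intro v hv
    apply h₁
    ext i
    have := congrFun hv (Sum.inl i)
    simpa [fromRows_mulVec] using this

/-- The event that the empirical second moment matrix of a design is well conditioned. -/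
def WellConditioned (c : ℝ) (z : Fin n → Fin d → ℝ) : Prop :=
  (NormedSpace.exp (-(1 / 2 : ℝ) • partialGram Finset.univ z)).trace <
    Real.exp (-(1 / 2) * (c * n / 8))

theorem measurableSet_wellConditioned (c : ℝ) :
    MeasurableSet {z : Fin n → Fin d → ℝ | WellConditioned c z} := by
  refine measurableSet_lt ?_ measurable_const
  exact (continuous_exp_partialGram Finset.univ (1 / 2)).matrix_trace.measurable

/-- The trace dominates exp(-λ/2) for each eigenvalue λ of the Gram matrix, so all of them exceed
cn/8. -/
theorem WellConditioned.lt {c : ℝ} {z : Fin n → Fin d → ℝ} (h : WellConditioned c z)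
    {v : Fin d → ℝ} (hv : v ≠ 0) :
    c * n / 8 * (v ⬝ᵥ v) < (Matrix.of z *ᵥ v) ⬝ᵥ (Matrix.of z *ᵥ v) := by
  rw [← dotProduct_partialGram_mulVec]
  exact lt_dotProduct_mulVec_of_trace_exp_lt (isHermitian_partialGram _ _) (by norm_num) h hv

theorem WellConditioned.eq_zero {c : ℝ} (hc : 0 ≤ c) {z : Fin n → Fin d → ℝ}
    (h : WellConditioned c z) (v : Fin d → ℝ) (hv : Matrix.of z *ᵥ v = 0) : v = 0 := by
  by_contra hne
  have h1 := h.lt hne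
  rw [hv, dotProduct_zero] at h1
  have h2 : 0 ≤ c * n / 8 * (v ⬝ᵥ v) := mul_nonneg (by positivity) (real_dotProduct_self_nonneg v)
  linarith

theorem dotProduct_self_eq_norm_sq (v : EuclideanSpace ℝ (Fin d)) :
    (v : Fin d → ℝ) ⬝ᵥ v = ‖v‖ ^ 2 := by
  rw [EuclideanSpace.real_norm_sq_eq, dotProduct]
  exact Finset.sum_congr rfl fun i _ => (sq _).symm

/-- Two clients with separated parameters pass the homogeneity test with small probability. -/
theorem noncentralChiSq_Iic_le_of_separated {σ γ c p υ : ℝ} (hσ : 0 < σ) (hγ : 0 < γ)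
    (hc : 0 < c) (hp : 0 < p) (hd : 0 < d) {z₁ z₂ : Fin n → Fin d → ℝ}
    (h₁ : WellConditioned c z₁) (h₂ : WellConditioned c z₂)
    {θ₁ θ₂ : EuclideanSpace ℝ (Fin d)} (hθ : γ ≤ ‖θ₁ - θ₂‖)
    (hn : 16 * chiSqInvNoncentrality p d υ * σ ^ 2 / (c * γ ^ 2) ≤ n) :
    noncentralChiSq (testDF (Matrix.of z₁) (Matrix.of z₂)) (homogeneityStat σ (Matrix.of z₁)
      (Matrix.of z₁ *ᵥ θ₁) (Matrix.of z₂) (Matrix.of z₂ *ᵥ θ₂)) (Set.Iic υ) ≤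
      ENNReal.ofReal p := by
  rw [testDF_eq_of_injective (h₁.eq_zero hc.le) (h₂.eq_zero hc.le), ← ofReal_chiSqCDF]
  refine ENNReal.ofReal_le_ofReal (chiSqCDF_le_of_chiSqInvNoncentrality_lt hp hd ?_)
  have hne : (θ₁ : Fin d → ℝ) ≠ θ₂ := by
    intro h
    have : θ₁ = θ₂ := PiLp.ext fun i => congrFun h i
    rw [this, sub_self, norm_zero] at hθ
    linarith
  -- The factor 16 is 8 · 2: the eigenvalue bound cn/8 and the 2 lost to the pooled estimate give ψ
  -- > cnγ²/(16σ²).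
  refine lt_of_le_of_lt ?_ (lt_homogeneityStat_mulVec hσ (c := c * n / 8) (by positivity)
    (fun v hv => h₁.lt hv) (fun v hv => h₂.lt hv) hne)
  rw [div_le_iff₀ (by positivity)] at hn
  have hnorm : (θ₁.ofLp - θ₂.ofLp) ⬝ᵥ (θ₁.ofLp - θ₂.ofLp) = ‖θ₁ - θ₂‖ ^ 2 :=
    dotProduct_self_eq_norm_sq (θ₁ - θ₂)
  have hsq : γ ^ 2 ≤ ‖θ₁ - θ₂‖ ^ 2 := by gcongr
  rw [hnorm, le_div_iff₀ (by positivity)]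
  have := mul_le_mul_of_nonneg_left hsq (show 0 ≤ c * n / 8 by positivity)
  nlinarith

/-- The non-centrality parameter of the test for two clients with close parameters. -/
theorem homogeneityStat_mulVec_le_of_close {σ : ℝ} {N T : ℕ} (hN : 0 < N) (hT : 0 < T)
    (hnT : n ≤ T) {z₁ z₂ : Fin n → Fin d → ℝ} (hz : ∀ t, z₁ t ⬝ᵥ z₁ t ≤ 1)
    {θ₁ θ₂ : EuclideanSpace ℝ (Fin d)} (hθ : ‖θ₁ - θ₂‖ ≤ 1 / (N * √T)) :
    homogeneityStat σ (Matrix.of z₁) (Matrix.of z₁ *ᵥ θ₁) (Matrix.of z₂) (Matrix.of z₂ *ᵥ θ₂) ≤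
      1 / σ ^ 2 := by
  refine (homogeneityStat_mulVec_le _ _ _ _ _).trans ?_
  gcongr
  set v : Fin d → ℝ := θ₁.ofLp - θ₂.ofLp with hv
  have hnorm : v ⬝ᵥ v = ‖θ₁ - θ₂‖ ^ 2 := dotProduct_self_eq_norm_sq (θ₁ - θ₂)
  have hrow : ∀ t, (z₁ t ⬝ᵥ v) * (z₁ t ⬝ᵥ v) ≤ v ⬝ᵥ v := by
    intro t
    have hcs := Finset.sum_mul_sq_le_sq_mul_sq Finset.univ (z₁ t) v
    have h1 : ∑ a, z₁ t a ^ 2 ≤ 1 := by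
      simpa [dotProduct, sq] using hz t
    have h2 : ∑ a, v a ^ 2 = v ⬝ᵥ v := by simp [dotProduct, sq]
    rw [h2] at hcs
    calc (z₁ t ⬝ᵥ v) * (z₁ t ⬝ᵥ v) = (∑ a, z₁ t a * v a) ^ 2 := (sq _).symm
      _ ≤ (∑ a, z₁ t a ^ 2) * (v ⬝ᵥ v) := hcs
      _ ≤ 1 * (v ⬝ᵥ v) := by gcongr; exact real_dotProduct_self_nonneg v
      _ = v ⬝ᵥ v := one_mul _
  have hsum : (Matrix.of z₁ *ᵥ v) ⬝ᵥ (Matrix.of z₁ *ᵥ v) ≤ n * (v ⬝ᵥ v) := by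
    refine (Finset.sum_le_sum fun t _ => hrow t).trans ?_
    simp
  refine hsum.trans ?_
  rw [hnorm]
  have hN1 : (1 : ℝ) ≤ N := by exact_mod_cast hN
  have hT0 : (0 : ℝ) < T := by exact_mod_cast hT
  have hnT' : (n : ℝ) ≤ T := by exact_mod_cast hnT
  -- The bound n ≤ T cancels the √T of the proximity radius.
  calc (n : ℝ) * ‖θ₁ - θ₂‖ ^ 2 ≤ (T : ℝ) * (1 / (N * √T)) ^ 2 := by gcongr
    _ = 1 / (N : ℝ) ^ 2 := by
        rw [div_pow, mul_pow, Real.sq_sqrt hT0.le]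
        field_simp
    _ ≤ 1 := by
        rw [div_le_one (by positivity)]
        exact one_le_pow₀ hN1

/-- The homogeneity statistic as a function of the two designs and the joint noise vector. -/
noncomputable def pairStat (σ : ℝ) (θ₁ θ₂ : Fin d → ℝ)
    (q : ((Fin n → Fin d → ℝ) × (Fin n → Fin d → ℝ)) × (Fin n ⊕ Fin n → ℝ)) : ℝ :=
  homogeneityStat σ (Matrix.of q.1.1) (Matrix.of q.1.1 *ᵥ θ₁ + q.2 ∘ Sum.inl)
    (Matrix.of q.1.2) (Matrix.of q.1.2 *ᵥ θ₂ + q.2 ∘ Sum.inr)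

theorem measurable_pairStat (σ : ℝ) (θ₁ θ₂ : Fin d → ℝ) :
    Measurable (pairStat (n := n) σ θ₁ θ₂) := by
  have c1 : Continuous fun q : ((Fin n → Fin d → ℝ) × (Fin n → Fin d → ℝ)) ×
      (Fin n ⊕ Fin n → ℝ) => Matrix.of q.1.1 := continuous_fst.comp continuous_fst
  have c2 : Continuous fun q : ((Fin n → Fin d → ℝ) × (Fin n → Fin d → ℝ)) ×
      (Fin n ⊕ Fin n → ℝ) => Matrix.of q.1.2 := continuous_snd.comp continuous_fst
  refine measurable_homogeneityStat σ c1 c2 ?_ ?_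
  · refine (c1.matrix_mulVec continuous_const).add ?_
    exact continuous_pi fun t => (continuous_apply (Sum.inl t)).comp continuous_snd
  · refine (c2.matrix_mulVec continuous_const).add ?_
    exact continuous_pi fun t => (continuous_apply (Sum.inr t)).comp continuous_snd

/-- Conditioning on the designs: a bound on the conditional law of the homogeneity statistic
gives a bound on its law. -/
theorem measure_pairStat_mem_le {Ω : Type*} [MeasurableSpace Ω] {μ : Measure Ω}
    [IsProbabilityMeasure μ] {σ : ℝ} (hσ : 0 < σ) (θ₁ θ₂ : Fin d → ℝ)
    {D : Ω → (Fin n → Fin d → ℝ) × (Fin n → Fin d → ℝ)} {η : Ω → Fin n ⊕ Fin n → ℝ}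
    (hD : Measurable D) (hη : Measurable η) (hind : IndepFun D η μ)
    (hlaw : μ.map η = Measure.pi fun _ => gaussianReal 0 (Real.toNNReal (σ ^ 2)))
    {G : Set ((Fin n → Fin d → ℝ) × (Fin n → Fin d → ℝ))} (hG : MeasurableSet G)
    {A : Set ℝ} (hA : MeasurableSet A) {p : ENNReal}
    (hp : ∀ᵐ ω ∂μ, D ω ∈ G →
      noncentralChiSq (testDF (Matrix.of (D ω).1) (Matrix.of (D ω).2))
        (homogeneityStat σ (Matrix.of (D ω).1) (Matrix.of (D ω).1 *ᵥ θ₁)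
          (Matrix.of (D ω).2) (Matrix.of (D ω).2 *ᵥ θ₂)) A ≤ p) :
    μ {ω | D ω ∈ G ∧ pairStat σ θ₁ θ₂ (D ω, η ω) ∈ A} ≤ p := by
  have hB : MeasurableSet ((Prod.fst ⁻¹' G) ∩ pairStat σ θ₁ θ₂ ⁻¹' A) :=
    (measurable_fst hG).inter (measurable_pairStat σ θ₁ θ₂ hA)
  refine measure_prodMk_mem_le hD hη hind hB ?_
  filter_upwards [hp] with ω hω
  by_cases hmem : D ω ∈ G
  · have hslice : Prod.mk (D ω) ⁻¹' ((Prod.fst ⁻¹' G) ∩ pairStat σ θ₁ θ₂ ⁻¹' A) =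
        (fun e => pairStat σ θ₁ θ₂ (D ω, e)) ⁻¹' A :=
      Set.ext fun e => ⟨fun he => he.2, fun he => ⟨hmem, he⟩⟩
    refine le_trans (le_of_eq ?_) (hω hmem)
    rw [hslice, hlaw, ← map_homogeneityStat hσ]
    exact (Measure.map_apply (f := fun e => pairStat σ θ₁ θ₂ (D ω, e))
      ((measurable_pairStat σ θ₁ θ₂).comp measurable_prodMk_left) hA).symm
  -- Designs outside G contribute nothing, so the conditional bound is only needed on G.
  · have hempty : Prod.mk (D ω) ⁻¹' ((Prod.fst ⁻¹' G) ∩ pairStat σ θ₁ θ₂ ⁻¹' A) = ∅ :=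
      Set.eq_empty_of_forall_notMem fun e he => hmem he.1
    rw [hempty, measure_empty]
    exact zero_le

/-! ### Law of the played arms and of the noise. -/

section Exploration

variable {Ω : Type*} {N K : ℕ}
  {arm : Fin n → Fin N → Fin K → Ω → EuclideanSpace ℝ (Fin d)}
  {choice : Fin n → Fin N → Ω → Fin K} {noise : Fin n → Fin N → Ω → ℝ}

/-- The arm played by client `i` in round `t`. -/
def playedArm (arm : Fin n → Fin N → Fin K → Ω → EuclideanSpace ℝ (Fin d))
    (choice : Fin n → Fin N → Ω → Fin K) (i : Fin N) (t : Fin n) (ω : Ω) : Fin d → ℝ :=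
  arm t i (choice t i ω) ω

theorem reward_eq (θ : Fin N → EuclideanSpace ℝ (Fin d)) (ω : Ω) (i : Fin N) :
    reward θ arm choice noise ω i =
      Matrix.of (fun t => playedArm arm choice i t ω) *ᵥ θ i + fun t => noise t i ω := by
  ext t
  simp [reward, playedArm, PiLp.inner_apply, Matrix.mulVec, dotProduct]

theorem measurable_eval_prod :
    Measurable fun r : (Fin K → EuclideanSpace ℝ (Fin d)) × Fin K => (r.1 r.2 : Fin d → ℝ) :=
  measurable_from_prod_countable_left fun k => by fun_prop

namespace IsExploration

variable [MeasurableSpace Ω] {μ : Measure Ω} {σ lamc : ℝ}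
  (h : IsExploration μ σ lamc arm choice noise)
include h

theorem measurable_playedArm (i : Fin N) (t : Fin n) : Measurable (playedArm arm choice i t) :=
  measurable_eval_prod.comp
    ((measurable_pi_lambda _ fun k => h.measurable_arm t i k).prodMk (h.measurable_choice t i))

theorem playedArm_dotProduct_le (i : Fin N) (t : Fin n) (ω : Ω) :
    playedArm arm choice i t ω ⬝ᵥ playedArm arm choice i t ω ≤ 1 := by
  rw [playedArm, dotProduct_self_eq_norm_sq]
  exact pow_le_one₀ (norm_nonneg _) (h.arm_norm_le t i _ ω)

theorem iIndepFun_playedArm (i : Fin N) : iIndepFun (playedArm arm choice i) μ :=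
  (h.round_indep i).comp (fun _ r => (r.1 r.2 : Fin d → ℝ)) fun _ => measurable_eval_prod

/-- Splitting over the chosen index, independence of index and arm set makes the second moment the
average of those of the K arms. -/
theorem le_integral_playedArm [IsProbabilityMeasure μ] (i : Fin N) (t : Fin n)
    (v : Fin d → ℝ) :
    lamc * (v ⬝ᵥ v) ≤ ∫ ω, (playedArm arm choice i t ω ⬝ᵥ v) ^ 2 ∂μ := by
  set w : EuclideanSpace ℝ (Fin d) := WithLp.toLp 2 v
  -- Any value of `choice` is an element of `Fin K`, so 1/K is a genuine inverse.
  have hK : (0 : ℝ) < K := by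
    obtain ⟨ω⟩ : Nonempty Ω := nonempty_of_isProbabilityMeasure μ
    exact_mod_cast (choice t i ω).pos
  have hinner : ∀ a : EuclideanSpace ℝ (Fin d), (a : Fin d → ℝ) ⬝ᵥ v = inner ℝ a w := by
    intro a
    simp [w, PiLp.inner_apply, dotProduct, mul_comm]
  have hint : ∀ k, Integrable (fun ω => (inner ℝ (arm t i k ω) w) ^ 2) μ := by
    intro k
    refine Integrable.of_bound (((h.measurable_arm t i k).inner_const).pow_const
      2).aestronglyMeasurable (‖w‖ ^ 2) (Filter.Eventually.of_forall fun ω => ?_)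
    rw [Real.norm_eq_abs, abs_pow]
    gcongr
    exact (abs_real_inner_le_norm _ _).trans
      (mul_le_of_le_one_left (norm_nonneg _) (h.arm_norm_le t i k ω))
  have hmeas : ∀ k, MeasurableSet {ω | choice t i ω = k} := fun k =>
    h.measurable_choice t i (measurableSet_singleton k)
  have hind : ∀ k, IndepFun (fun ω => if choice t i ω = k then (1 : ℝ) else 0)
      (fun ω => (inner ℝ (arm t i k ω) w) ^ 2) μ := by
    intro k
    refine (h.choice_indep t i).comp (φ := fun c => if c = k then (1 : ℝ) else 0)
      (ψ := fun A : Fin K → EuclideanSpace ℝ (Fin d) => (inner ℝ (A k) w) ^ 2)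
      (measurable_of_countable _) (by fun_prop)
  have hif : ∀ k, (fun ω => if choice t i ω = k then (1 : ℝ) else 0) =
      {ω | choice t i ω = k}.indicator 1 := fun k => by
    ext ω
    simp [Set.indicator_apply]
  have hind1 : ∀ k, Integrable (fun ω => if choice t i ω = k then (1 : ℝ) else 0) μ := fun k => by
    rw [hif]
    exact (integrable_const (1 : ℝ)).indicator (hmeas k)
  have hind2 : ∀ k, Integrable (fun ω =>
      (if choice t i ω = k then (1 : ℝ) else 0) * (inner ℝ (arm t i k ω) w) ^ 2) μ := fun k =>
    (hind k).integrable_mul (hind1 k) (hint k)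
  have hdecomp : ∀ ω, (playedArm arm choice i t ω ⬝ᵥ v) ^ 2 =
      ∑ k, (if choice t i ω = k then (1 : ℝ) else 0) * (inner ℝ (arm t i k ω) w) ^ 2 := by
    intro ω
    simp [playedArm, hinner]
  have hprob : ∀ k, ∫ ω, (if choice t i ω = k then (1 : ℝ) else 0) ∂μ = 1 / K := by
    intro k
    rw [← h.choice_uniform t i k, ← integral_indicator_one (hmeas k), hif]
  simp only [hdecomp]
  rw [integral_finsetSum _ fun k _ => hind2 k]
  have hterm : ∀ k, 1 / K * (lamc * (v ⬝ᵥ v)) ≤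
      ∫ ω, (if choice t i ω = k then (1 : ℝ) else 0) * (inner ℝ (arm t i k ω) w) ^ 2 ∂μ := by
    intro k
    rw [(hind k).integral_fun_mul_eq_mul_integral (hind1 k).aestronglyMeasurable
      (hint k).aestronglyMeasurable, hprob]
    gcongr
    have := h.arm_regular t i k w
    rwa [← dotProduct_self_eq_norm_sq] at this
  calc lamc * (v ⬝ᵥ v) = ∑ _k : Fin K, 1 / K * (lamc * (v ⬝ᵥ v)) := by
        rw [Finset.sum_const, Finset.card_univ, Fintype.card_fin, nsmul_eq_mul]
        field_simp
    _ ≤ _ := Finset.sum_le_sum fun k _ => hterm k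

theorem measure_not_wellConditioned_le [IsProbabilityMeasure μ] {T : ℕ} (hN : 0 < N)
    (hT : 0 < T) (hd : 0 < d) (hlamc : 0 < lamc) {δ : ℝ} (hδ₀ : 0 < δ) (hδ₁ : δ < 1)
    (hn : 64 / (3 * lamc) * Real.log (2 * N * T * d / δ) ≤ n) (i : Fin N) :
    μ {ω | ¬ WellConditioned lamc fun t => playedArm arm choice i t ω} ≤
      ENNReal.ofReal (δ / (2 * N)) := by
  have h1 := measureReal_trace_exp_partialGram_ge_le (h.iIndepFun_playedArm i)
    (h.measurable_playedArm i) (h.playedArm_dotProduct_le i)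
    (fun t v => h.le_integral_playedArm i t v)
  rw [Fintype.card_fin] at h1
  have hN1 : (1 : ℝ) ≤ N := by exact_mod_cast hN
  have hT1 : (1 : ℝ) ≤ T := by exact_mod_cast hT
  have hd1 : (1 : ℝ) ≤ d := by exact_mod_cast hd
  have hR : 0 < 2 * N * T * d / δ := by positivity
  have hR1 : 1 ≤ 2 * N * T * d / δ := by
    rw [one_le_div hδ₀]
    have : (1 : ℝ) ≤ N * T * d := one_le_mul_of_one_le_of_one_le
      (one_le_mul_of_one_le_of_one_le hN1 hT1) hd1
    nlinarith
  have hlog : 0 ≤ Real.log (2 * N * T * d / δ) := Real.log_nonneg hR1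
  -- The hypothesis even yields 3λn/64; nonnegativity of the logarithm allows the weaker 3λn/16 that
  -- the tail bound needs.
  have hexp : Real.log (2 * N * T * d / δ) ≤ 3 * lamc * n / 16 := by
    rw [div_mul_eq_mul_div, div_le_iff₀ (by positivity)] at hn
    linarith
  have h2 : d * Real.exp (-(3 * lamc * n / 16)) ≤ δ / (2 * N) := by
    calc d * Real.exp (-(3 * lamc * n / 16))
        ≤ d * Real.exp (-Real.log (2 * N * T * d / δ)) := by gcongr
      _ = δ / (2 * N) / T := by
          rw [Real.exp_neg, Real.exp_log hR]
          field_simp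
      _ ≤ δ / (2 * N) := div_le_self (by positivity) hT1
  have h3 := ENNReal.ofReal_le_ofReal (h1.trans h2)
  rw [ofReal_measureReal] at h3
  simpa only [WellConditioned, not_lt] using h3

/-- The noise of a pair of distinct clients. -/
theorem map_pairNoise [IsProbabilityMeasure μ] {i j : Fin N} (hij : i ≠ j) :
    μ.map (fun ω => (Sum.elim (fun t => noise t i ω) (fun t => noise t j ω) :
      Fin n ⊕ Fin n → ℝ)) =
      Measure.pi fun _ : Fin n ⊕ Fin n => gaussianReal 0 (Real.toNNReal (σ ^ 2)) := by
  let g : Fin n ⊕ Fin n → Fin n × Fin N := Sum.elim (fun t => (t, i)) fun t => (t, j)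
  have hg : Function.Injective g := by
    rintro (a | a) (b | b) hab <;> simp_all [g, Prod.ext_iff]
  have hpre := h.noise_indep.precomp hg
  rw [iIndepFun_iff_map_fun_eq_pi_map
    (fun k => (h.measurable_noise (g k).1 (g k).2).aemeasurable)] at hpre
  have hlaw : ∀ k, μ.map (fun ω => noise (g k).1 (g k).2 ω) =
      gaussianReal 0 (Real.toNNReal (σ ^ 2)) := fun k => (h.noise_law _ _).map_eq
  simp only [hlaw] at hpre
  rw [← hpre]
  congr 1
  ext ω (t | t) <;> rfl

/-- Both designs are functions of the whole array of arm sets and choices, from which the noise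
array is independent. The two designs may depend on each other. -/
theorem indepFun_playedArm_pairNoise (i j : Fin N) :
    IndepFun (fun ω => ((fun t => playedArm arm choice i t ω), fun t => playedArm arm choice j t ω))
      (fun ω => (Sum.elim (fun t => noise t i ω) (fun t => noise t j ω) :
        Fin n ⊕ Fin n → ℝ)) μ := by
  have hf : Measurable fun e : Fin n × Fin N → ℝ =>
      (Sum.elim (fun t => e (t, i)) (fun t => e (t, j)) : Fin n ⊕ Fin n → ℝ) := by
    refine measurable_pi_lambda _ ?_
    rintro (t | t) <;> exact measurable_pi_apply _
  have hrow : ∀ k : Fin N, Measurable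
      fun (q : Fin n × Fin N → (Fin K → EuclideanSpace ℝ (Fin d)) × Fin K) (t : Fin n) =>
        ((q (t, k)).1 (q (t, k)).2 : Fin d → ℝ) := fun k =>
    measurable_pi_lambda _ fun t => measurable_eval_prod.comp (measurable_pi_apply (t, k))
  exact (h.noise_indep_arm.comp hf ((hrow i).prodMk (hrow j))).symm

end IsExploration

end Exploration

/-! ### Error probabilities per pair and the union bound. -/

/-- There are N(N-1)/2 unordered pairs. The factor 1/2 saved here leaves δ/2 for ill conditioned
designs. -/
theorem sum_Iio_const_le (N : ℕ) {ε : ℝ} (hε : 0 ≤ ε) :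
    ∑ j : Fin N, ∑ _i ∈ Finset.Iio j, ENNReal.ofReal ε ≤ ENNReal.ofReal (N ^ 2 / 2 * ε) := by
  have h1 : ∀ j : Fin N, ∑ _i ∈ Finset.Iio j, ENNReal.ofReal ε =
      ENNReal.ofReal ((j : ℕ) * ε) := by
    intro j
    rw [Finset.sum_const, Fin.card_Iio, ← ENNReal.ofReal_nsmul, nsmul_eq_mul]
  simp only [h1]
  rw [← ENNReal.ofReal_sum_of_nonneg fun j _ => by positivity, ← Finset.sum_mul]
  refine ENNReal.ofReal_le_ofReal (mul_le_mul_of_nonneg_right ?_ hε)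
  rw [Fin.sum_univ_eq_sum_range (fun k => (k : ℝ)) N]
  have h2 := Finset.sum_range_id_mul_two N
  have h3 : ((∑ k ∈ Finset.range N, k : ℕ) : ℝ) * 2 ≤ N * N := by
    exact_mod_cast h2.le.trans (Nat.mul_le_mul_left N (Nat.sub_le N 1))
  push_cast at h3
  nlinarith

section Exploration

variable {Ω : Type*} {N K d n T : ℕ} {σ γ lamc δ υ : ℝ} {θ : Fin N → EuclideanSpace ℝ (Fin d)}
  {C : Finpartition (Finset.univ : Finset (Fin N))}
  {arm : Fin n → Fin N → Fin K → Ω → EuclideanSpace ℝ (Fin d)}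
  {choice : Fin n → Fin N → Ω → Fin K} {noise : Fin n → Fin N → Ω → ℝ}

/-- The homogeneity statistic of clients `i` and `j` after the exploration phase. -/
noncomputable def explorationStat (σ : ℝ) (θ : Fin N → EuclideanSpace ℝ (Fin d))
    (arm : Fin n → Fin N → Fin K → Ω → EuclideanSpace ℝ (Fin d))
    (choice : Fin n → Fin N → Ω → Fin K) (noise : Fin n → Fin N → Ω → ℝ) (i j : Fin N)
    (ω : Ω) : ℝ :=
  homogeneityStat σ (design arm choice ω i) (reward θ arm choice noise ω i)
    (design arm choice ω j) (reward θ arm choice noise ω j)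

/-- The statistic is symmetric, so the symmetrization in `SimpleGraph.fromRel` adds no edges. -/
theorem clientGraph_adj_iff (υ : ℝ) (ω : Ω) {i j : Fin N} (hij : i ≠ j) :
    (clientGraph σ υ (design arm choice ω) (reward θ arm choice noise ω)).Adj i j ↔
      explorationStat σ θ arm choice noise i j ω ≤ υ := by
  rw [clientGraph, SimpleGraph.fromRel_adj]
  simp only [homogeneityStat_comm σ (design arm choice ω j), or_self]
  exact and_iff_right hij

/-- The events that cover the failure of the cluster estimation. -/
def failure (σ υ lamc : ℝ) (θ : Fin N → EuclideanSpace ℝ (Fin d))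
    (C : Finpartition (Finset.univ : Finset (Fin N)))
    (arm : Fin n → Fin N → Fin K → Ω → EuclideanSpace ℝ (Fin d))
    (choice : Fin n → Fin N → Ω → Fin K) (noise : Fin n → Fin N → Ω → ℝ) (i j : Fin N) :
    Set Ω :=
  {ω | C.part i = C.part j ∧ υ < explorationStat σ θ arm choice noise i j ω} ∪
  {ω | C.part i ≠ C.part j ∧ (WellConditioned lamc (fun t => playedArm arm choice i t ω) ∧
      WellConditioned lamc (fun t => playedArm arm choice j t ω)) ∧
      explorationStat σ θ arm choice noise i j ω ≤ υ}

theorem estimatedClusters_eq_of_notMem_failure (hN : 0 < N) {ω : Ω}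
    (hwell : ∀ i, WellConditioned lamc fun t => playedArm arm choice i t ω)
    (hω : ∀ j, ∀ i < j, ω ∉ failure σ υ lamc θ C arm choice noise i j) :
    estimatedClusters σ υ (design arm choice ω) (reward θ arm choice noise ω) =
      (C.parts : Set (Finset (Fin N))) := by
  have : Nonempty (Fin N) := ⟨⟨0, hN⟩⟩
  have hlt : ∀ i j, i < j → ((clientGraph σ υ (design arm choice ω)
      (reward θ arm choice noise ω)).Adj i j ↔ C.part i = C.part j) := by
    intro i j hij
    rw [clientGraph_adj_iff υ ω hij.ne]
    have h := hω j i hij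
    simp only [failure, Set.mem_union, Set.mem_ofPred_eq, not_or, not_and, not_lt, not_le] at h
    refine ⟨fun hle => ?_, h.1⟩
    by_contra hne
    exact absurd hle (not_le.2 (h.2 hne ⟨hwell i, hwell j⟩))
  refine maximalCliques_eq_parts fun i j hij => ?_
  rcases lt_or_gt_of_ne hij with hlt' | hgt
  · exact hlt i j hlt'
  · rw [SimpleGraph.adj_comm, hlt j i hgt, eq_comm]

variable [MeasurableSpace Ω] {μ : Measure Ω} [IsProbabilityMeasure μ]

theorem IsExploration.measure_explorationStat_mem_le
    (h : IsExploration μ σ lamc arm choice noise) (hσ : 0 < σ)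
    (θ : Fin N → EuclideanSpace ℝ (Fin d)) {i j : Fin N} (hij : i ≠ j)
    {G : Set ((Fin n → Fin d → ℝ) × (Fin n → Fin d → ℝ))} (hG : MeasurableSet G)
    {A : Set ℝ} (hA : MeasurableSet A) {p : ENNReal}
    (hp : ∀ᵐ ω ∂μ,
      ((fun t => playedArm arm choice i t ω), fun t => playedArm arm choice j t ω) ∈ G →
      noncentralChiSq (testDF (design arm choice ω i) (design arm choice ω j))
        (homogeneityStat σ (design arm choice ω i) (design arm choice ω i *ᵥ θ i)
          (design arm choice ω j) (design arm choice ω j *ᵥ θ j)) A ≤ p) :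
    μ {ω | ((fun t => playedArm arm choice i t ω), fun t => playedArm arm choice j t ω) ∈ G ∧
      explorationStat σ θ arm choice noise i j ω ∈ A} ≤ p := by
  have hη : Measurable fun ω => (Sum.elim (fun t => noise t i ω) (fun t => noise t j ω) :
      Fin n ⊕ Fin n → ℝ) := by
    refine measurable_pi_lambda _ ?_
    rintro (t | t) <;> exact h.measurable_noise _ _
  have hD : Measurable fun ω =>
      ((fun t => playedArm arm choice i t ω), fun t => playedArm arm choice j t ω) :=
    (measurable_pi_lambda _ fun t => h.measurable_playedArm i t).prodMk
      (measurable_pi_lambda _ fun t => h.measurable_playedArm j t)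
  have key := measure_pairStat_mem_le hσ (θ i) (θ j) hD hη (h.indepFun_playedArm_pairNoise i j)
    (h.map_pairNoise hij) hG hA hp
  simp only [explorationStat, reward_eq]
  exact key

/-- Two clients of the same cluster are separated by the test with small probability. -/
theorem IsExploration.measure_same_cluster_le (h : IsExploration μ σ lamc arm choice noise)
    (hσ : 0 < σ) (hN : 0 < N) (hT : 0 < T) (hnT : n ≤ T) (hδ₀ : 0 < δ)
    (hC : IsClusterStructure T γ θ C)
    (hυ : ∀ᵐ ω ∂μ, ∀ i j : Fin N, i ≠ j →
      chiSqQuantile (1 - δ / (N : ℝ) ^ 2)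
        (testDF (design arm choice ω i) (design arm choice ω j)) (1 / σ ^ 2) ≤ υ)
    {i j : Fin N} (hij : i ≠ j) (hpart : C.part i = C.part j) :
    μ {ω | υ < explorationStat σ θ arm choice noise i j ω} ≤
      ENNReal.ofReal (δ / (N : ℝ) ^ 2) := by
  have hN' : (0 : ℝ) < N := by exact_mod_cast hN
  have hθ : ‖θ i - θ j‖ ≤ 1 / (N * √T) :=
    hC.proximity (C.part i) (C.part_mem.2 (Finset.mem_univ i)) i (C.mem_part (Finset.mem_univ i))
      j (hpart ▸ C.mem_part (Finset.mem_univ j))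
  -- No conditioning of the design is required: the threshold dominates the quantile at the random
  -- degrees of freedom.
  have key := h.measure_explorationStat_mem_le hσ θ hij MeasurableSet.univ
    (measurableSet_Ioi (a := υ)) (p := ENNReal.ofReal (δ / (N : ℝ) ^ 2)) ?_
  · simpa using key
  · filter_upwards [hυ] with ω hω _
    refine noncentralChiSq_Ioi_le (by positivity) _ ?_ (hω i j hij)
    exact homogeneityStat_mulVec_le_of_close hN hT hnT
      (fun t => h.playedArm_dotProduct_le i t ω) hθ

/-- Two clients of distinct clusters are joined by the test with small probability. -/
theorem IsExploration.measure_distinct_cluster_le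
    (h : IsExploration μ σ lamc arm choice noise)
    (hσ : 0 < σ) (hγ : 0 < γ) (hlamc : 0 < lamc) (hN : 0 < N) (hd : 0 < d) (hδ₀ : 0 < δ)
    (hC : IsClusterStructure T γ θ C) (hlong : LongEnough n N C.parts.card T d σ γ lamc δ υ)
    {i j : Fin N} (hpart : C.part i ≠ C.part j) :
    μ {ω | (WellConditioned lamc (fun t => playedArm arm choice i t ω) ∧
        WellConditioned lamc (fun t => playedArm arm choice j t ω)) ∧
      explorationStat σ θ arm choice noise i j ω ≤ υ} ≤ ENNReal.ofReal (δ / (N : ℝ) ^ 2) := by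
  have hN' : (0 : ℝ) < N := by exact_mod_cast hN
  have hij : i ≠ j := fun hij => hpart (hij ▸ rfl)
  have hi := C.part_mem.2 (Finset.mem_univ i)
  have hj := C.part_mem.2 (Finset.mem_univ j)
  have hM : 2 ≤ C.parts.card := Finset.one_lt_card.2 ⟨_, hi, _, hj, hpart⟩
  have hM' : (1 : ℝ) ≤ C.parts.card - 1 := by
    have : (2 : ℝ) ≤ C.parts.card := by exact_mod_cast hM
    linarith
  have hθ : γ ≤ ‖θ i - θ j‖ := hC.separation _ hi _ hj hpart i (C.mem_part (Finset.mem_univ i))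
    j (C.mem_part (Finset.mem_univ j))
  have hp : 0 < δ / ((N : ℝ) ^ 2 * (C.parts.card - 1)) := by positivity
  have key := h.measure_explorationStat_mem_le hσ θ hij
    (((measurableSet_wellConditioned (n := n) (d := d) lamc).preimage measurable_fst).inter
      ((measurableSet_wellConditioned lamc).preimage measurable_snd))
    (measurableSet_Iic (a := υ)) (Filter.Eventually.of_forall fun ω hω =>
      noncentralChiSq_Iic_le_of_separated hσ hγ hlamc hp hd hω.1 hω.2 hθ (hlong.2 hM))
  refine key.trans (ENNReal.ofReal_le_ofReal ?_)
  gcongr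
  -- The level δ/(N²(M-1)) is at most δ/N² because M ≥ 2.
  exact le_mul_of_one_le_right (by positivity) hM'

end Exploration

end HetoFedBandit

open HetoFedBandit

theorem theorem1 {Ω : Type*} [MeasurableSpace Ω] (μ : MeasureTheory.Measure Ω)
    [MeasureTheory.IsProbabilityMeasure μ]
    (N K d T T₀ : ℕ) (hN : 0 < N) (hd : 0 < d) (hT : 0 < T) (hT₀ : T₀ ≤ T)
    (σ γ lamc δ υ : ℝ) (hσ : 0 < σ) (hγ : 0 < γ) (hlamc : 0 < lamc) (hδ₀ : 0 < δ) (hδ₁ : δ < 1)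
    (θ : Fin N → EuclideanSpace ℝ (Fin d))
    (C : Finpartition (Finset.univ : Finset (Fin N)))
    (hC : HetoFedBandit.IsClusterStructure T γ θ C)
    (arm : Fin T₀ → Fin N → Fin K → Ω → EuclideanSpace ℝ (Fin d))
    (choice : Fin T₀ → Fin N → Ω → Fin K) (noise : Fin T₀ → Fin N → Ω → ℝ)
    (hexp : HetoFedBandit.IsExploration μ σ lamc arm choice noise)
    (hυ : ∀ᵐ ω ∂μ, ∀ i j : Fin N, i ≠ j →
      HetoFedBandit.chiSqQuantile (1 - δ / (N : ℝ) ^ 2)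
        (HetoFedBandit.testDF (HetoFedBandit.design arm choice ω i)
          (HetoFedBandit.design arm choice ω j))
        (1 / σ ^ 2) ≤ υ)
    (hlong : HetoFedBandit.LongEnough T₀ N C.parts.card T d σ γ lamc δ υ) :
    ENNReal.ofReal (1 - δ) ≤
      μ {ω | HetoFedBandit.estimatedClusters σ υ (HetoFedBandit.design arm choice ω)
        (HetoFedBandit.reward θ arm choice noise ω) = (C.parts : Set (Finset (Fin N)))} := by
  set good := {ω | estimatedClusters σ υ (design arm choice ω)
    (reward θ arm choice noise ω) = (C.parts : Set (Finset (Fin N)))} with hgood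
  set ill : Set Ω := ⋃ i : Fin N,
    {ω | ¬ WellConditioned lamc fun t => playedArm arm choice i t ω} with hill
  set fail : Set Ω := ⋃ j : Fin N, ⋃ i ∈ Finset.Iio j,
    failure σ υ lamc θ C arm choice noise i j with hfail
  have hN' : (0 : ℝ) < N := by exact_mod_cast hN
  -- Covering the space, rather than taking a complement, needs only subadditivity and no
  -- measurability of `good`.
  have hcover : Set.univ ⊆ good ∪ (ill ∪ fail) := by
    intro ω _
    by_contra hω
    simp only [Set.mem_union, not_or, hill, hfail, Set.mem_iUnion, Finset.mem_Iio, not_exists,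
      Set.mem_ofPred_eq, not_not] at hω
    exact hω.1 (estimatedClusters_eq_of_notMem_failure hN hω.2.1 hω.2.2)
  have h_ill : μ ill ≤ ENNReal.ofReal (δ / 2) := by
    refine (measure_iUnion_fintype_le μ _).trans ?_
    refine (Finset.sum_le_sum fun i _ => hexp.measure_not_wellConditioned_le hN hT hd hlamc
      hδ₀ hδ₁ hlong.1 i).trans (le_of_eq ?_)
    rw [Finset.sum_const, Finset.card_univ, Fintype.card_fin, ← ENNReal.ofReal_nsmul,
      nsmul_eq_mul]
    congr 1
    field_simp
  have h_failure : ∀ j, ∀ i < j, μ (failure σ υ lamc θ C arm choice noise i j) ≤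
      ENNReal.ofReal (δ / (N : ℝ) ^ 2) := by
    intro j i hij
    by_cases hpart : C.part i = C.part j
    · refine le_trans (measure_mono ?_) (hexp.measure_same_cluster_le hσ hN hT hT₀ hδ₀ hC hυ
        hij.ne hpart)
      rintro ω (hω | hω)
      · exact hω.2
      · exact absurd hpart hω.1
    · refine le_trans (measure_mono ?_) (hexp.measure_distinct_cluster_le hσ hγ hlamc hN hd hδ₀
        hC hlong hpart)
      rintro ω (hω | hω)
      · exact absurd hω.1 hpart
      · exact hω.2
  have h_fail : μ fail ≤ ENNReal.ofReal (δ / 2) := by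
    refine (measure_iUnion_fintype_le μ _).trans ?_
    refine (Finset.sum_le_sum fun j _ => (measure_biUnion_finset_le _ _).trans
      (Finset.sum_le_sum fun i hi => h_failure j i (Finset.mem_Iio.1 hi))).trans ?_
    refine (sum_Iio_const_le N (by positivity)).trans (le_of_eq ?_)
    congr 1
    field_simp
  have htotal : 1 ≤ μ good + ENNReal.ofReal δ := by
    calc (1 : ENNReal) = μ Set.univ := measure_univ.symm
      _ ≤ μ (good ∪ (ill ∪ fail)) := measure_mono hcover
      _ ≤ μ good + (μ ill + μ fail) :=
          (measure_union_le _ _).trans (add_le_add_right (measure_union_le _ _) _)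
      _ ≤ μ good + (ENNReal.ofReal (δ / 2) + ENNReal.ofReal (δ / 2)) := by gcongr
      _ = μ good + ENNReal.ofReal δ := by
          rw [← ENNReal.ofReal_add (by positivity) (by positivity), add_halves]
  rw [ENNReal.ofReal_sub _ hδ₀.le, ENNReal.ofReal_one]
  exact tsub_le_iff_right.2 htotal
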